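/- Let $V$ be a finite set of $n$ vertices with $4\mid n$, let $k\ge 1$ be an integer, and let $0<\epsilon<1$ and $0<\delta<1$. For a real matrix $M$ let $\sigma_1(M)\ge\sigma_2(M)\ge\cdots$ be its singular values (with $\sigma_i(M)=0$ when $i$ exceeds the number of columns), and let $\Pi_M^{(k)}=U_kU_k^{T}$, where the columns of $U_k$ are the first $k$ (all of them, if there are fewer than $k$) left singular vectors of $M$ in an orthonormal basis of left singular vectors ordered by decreasing singular value. Let $\mathrm{Lap}(b)$ be the law with density $\frac1{2b}e^{-|x|/b}$. The algorithm DPCommunity takes as input the adjacency matrix $\hat A$ of an arbitrary simple graph $G$ on $V$, together with $k,\epsilon,\delta$, and does the following, with all random choices independent. 1. Choose uniformly at random a partition $V=Y\sqcup Z_1\sqcup Z_2$ with $|Y|=n/2$, $|Z_1|=|Z_2|=n/4$. Let $\hat A_1$ and $\hat A_2$ be the submatrices of $\hat A$ with rows $Y$ and columns $Z_1$ and $Z_2$, respectively. 2. Set $\tilde d_k=\sigma_k(\hat A_1)-\sigma_{k+1}(\hat A_1)-\frac8\epsilon\ln\frac4\delta+\mathrm{Lap}(\frac8\epsilon)$ and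 $\tilde\sigma_1=\sigma_1(\hat A_2)+\frac4\epsilon\ln\frac4\delta+\mathrm{Lap}(\frac4\epsilon)$. 3. If $\tilde d_k\le 10\cdot\frac8\epsilon\ln\frac4\delta$, return $\perp$. 4. Otherwise set $\tilde\Gamma=\tilde\sigma_1/\tilde d_k$ and $m=\lceil 64\ln\frac{2n}{\delta}\rceil$. Draw an $m\times\frac n2$ matrix $P$ with independent centred Gaussian entries of standard deviation $1/\sqrt m$, and an $m\times\frac n4$ matrix $N$ with independent standard Gaussian entries, and return the set $Z_2$ together with the matrix $$\tilde F=P\,\Pi_{\hat A_1}^{(k)}\hat A_2+\frac{3k\tilde\Gamma}{\epsilon}\sqrt{2\ln\tfrac5\delta}\;N,$$ whose columns are indexed by $Z_2$. Then DPCommunity is $(\epsilon,\delta)$-differentially private with respect to a change of one edge: for all graphs $G,G'$ on $V$ that differ in at most one edge and every measurable set $S$ of outputs, $$\Pr[\mathrm{DPCommunity}(G)\in S]\le e^{\epsilon}\,\Pr[\mathrm{DPCommunity}(G')\in S]+\delta .$$ The same holds for the joint release of the partition $(Y,Z_1,Z_2)$, the noisy values $\tilde d_k$ and $\tilde\sigma_1$,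 and the result ($\perp$ or $\tilde F$). -/

import Mathlib

open MeasureTheory ProbabilityTheory

namespace DPComm

/-! ### Edge differential privacy -/

section Privacy

variable {V : Type*}

/-- Two simple graphs on the same vertex set are adjacent if they differ in at most one edge. -/
def EdgeAdjacent (G G' : SimpleGraph V) : Prop :=
  (symmDiff G.edgeSet G'.edgeSet).encard ≤ 1

/-- `(ε, δ)`-edge differential privacy of a randomized algorithm, which is given by the law of its
output on every input graph. -/
def IsEdgeDP {Out : Type*} [MeasurableSpace Out] (ε δ : ℝ)
    (M : SimpleGraph V → Measure Out) : Prop :=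
  ∀ G G' : SimpleGraph V, EdgeAdjacent G G' → ∀ S : Set Out, MeasurableSet S →
    M G S ≤ ENNReal.ofReal (Real.exp ε) * M G' S + ENNReal.ofReal δ

end Privacy

/-! ### Singular values and spectral projections -/

section Spectral

variable {m n : Type*} [Fintype m] [DecidableEq m] [Fintype n] [DecidableEq n]

/-- The `i`-th largest singular value of `M`, for `i = 1, 2, …` (Mathlib counts from `0`), with the
usual convention that it is `0` beyond the number of columns. -/
noncomputable def sigma (M : Matrix m n ℝ) (i : ℕ) : ℝ :=
  (Matrix.toEuclideanLin M).singularValues (i - 1)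

/-- Left singular vectors of `M`: an orthonormal basis of eigenvectors of `M Mᵀ`, ordered by
decreasing eigenvalue. -/
noncomputable def leftSingularBasis (M : Matrix m n ℝ) :
    OrthonormalBasis (Fin (Fintype.card m)) ℝ (EuclideanSpace ℝ m) :=
  (LinearMap.isSymmetric_self_comp_adjoint (Matrix.toEuclideanLin M)).eigenvectorBasis
    finrank_euclideanSpace

/-- The matrix `U_k` whose columns are the top `k` left singular vectors of `M`. -/
noncomputable def topLeft (k : ℕ) (M : Matrix m n ℝ) :
    Matrix m {i : Fin (Fintype.card m) // (i : ℕ) < k} ℝ :=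
  Matrix.of fun y i => leftSingularBasis M i.1 y

/-- `Π_M^{(k)} = U_k U_kᵀ`. -/
noncomputable def topProj (k : ℕ) (M : Matrix m n ℝ) : Matrix m m ℝ :=
  topLeft k M * (topLeft k M).transpose

end Spectral

/-! ### Noise distributions -/

section Noise

/-- The centred Laplace distribution `Lap(b)`, with density `exp (-|x| / b) / (2 b)`. -/
noncomputable def laplace (b : ℝ) : Measure ℝ :=
  volume.withDensity fun x => ENNReal.ofReal (Real.exp (-|x| / b) / (2 * b))

/-- The law of an `a × b` matrix with independent centred Gaussian entries of standard
deviation `s`. -/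
noncomputable def gaussianMatrix (a b : Type*) [Fintype a] [Fintype b] (s : ℝ) :
    Measure (a → b → ℝ) :=
  Measure.pi fun _ => Measure.pi fun _ => gaussianReal 0 (s ^ 2).toNNReal

end Noise

/-! ### The algorithm -/

section Algorithm

variable {V : Type*} [Fintype V] [DecidableEq V]

/-- The partitions `V = Y ⊔ Z₁ ⊔ Z₂` with `|Y| = n / 2` and `|Z₁| = |Z₂| = n / 4`. -/
def Split (V : Type*) [Fintype V] [DecidableEq V] : Type _ :=
  {s : Finset V × Finset V × Finset V //
    Disjoint s.1 s.2.1 ∧ Disjoint s.1 s.2.2 ∧ Disjoint s.2.1 s.2.2 ∧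
    s.1 ∪ s.2.1 ∪ s.2.2 = Finset.univ ∧
    s.1.card = Fintype.card V / 2 ∧
    s.2.1.card = Fintype.card V / 4 ∧ s.2.2.card = Fintype.card V / 4}

noncomputable instance : Fintype (Split V) := by
  classical
  unfold Split
  infer_instance

/-- The rows `Y`. -/
def Split.Y (s : Split V) : Finset V := s.1.1
/-- The columns `Z₁` of the first submatrix. -/
def Split.Z₁ (s : Split V) : Finset V := s.1.2.1
/-- The columns `Z₂` of the second submatrix. -/
def Split.Z₂ (s : Split V) : Finset V := s.1.2.2

open Classical in
/-- The submatrix of the adjacency matrix of `G` with rows `R` and columns `C`. -/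
noncomputable def subAdj (G : SimpleGraph V) (R C : Finset V) : Matrix R C ℝ :=
  (G.adjMatrix ℝ).submatrix Subtype.val Subtype.val

/-- The dimension `⌈64 ln (2n/δ)⌉` of the random projection. -/
noncomputable def projDim (V : Type*) [Fintype V] (δ : ℝ) : ℕ :=
  ⌈64 * Real.log (2 * (Fintype.card V : ℝ) / δ)⌉₊

/-- All the noise used once the partition is fixed: the two Laplace variables, the projection
matrix `P`, and a standard Gaussian matrix. -/
abbrev Noise (δ : ℝ) (s : Split V) : Type _ :=
  ℝ × ℝ × (Fin (projDim V δ) → s.Y → ℝ) × (Fin (projDim V δ) → s.Z₂ → ℝ)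

/-- The law of the noise: `Lap(8/ε)`, `Lap(4/ε)`, `𝒩(0, 1/√m)` with `1/√m` the standard
deviation, and `𝒩(0, 1)`, all independent. -/
noncomputable def noiseLaw (ε δ : ℝ) (s : Split V) : Measure (Noise δ s) :=
  (laplace (8 / ε)).prod ((laplace (4 / ε)).prod
    ((gaussianMatrix (Fin (projDim V δ)) s.Y (1 / √(projDim V δ : ℝ))).prod
      (gaussianMatrix (Fin (projDim V δ)) s.Z₂ 1)))

/-- `d̃_k = σ_k(Â₁) - σ_{k+1}(Â₁) - (8/ε) ln (4/δ) + x`, where `x` is the Laplace noise. -/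
noncomputable def noisyGap (ε δ : ℝ) (k : ℕ) (G : SimpleGraph V) (s : Split V) (x : ℝ) : ℝ :=
  sigma (subAdj G s.Y s.Z₁) k - sigma (subAdj G s.Y s.Z₁) (k + 1)
    - 8 / ε * Real.log (4 / δ) + x

/-- `σ̃₁ = σ₁(Â₂) + (4/ε) ln (4/δ) + x`, where `x` is the Laplace noise. -/
noncomputable def noisyTop (ε δ : ℝ) (G : SimpleGraph V) (s : Split V) (x : ℝ) : ℝ :=
  sigma (subAdj G s.Y s.Z₂) 1 + 4 / ε * Real.log (4 / δ) + x

/-- `F̃ = P Π_{Â₁}^{(k)}(Â₂) + (3 k Γ̃ / ε) √(2 ln (5/δ)) N`, where `Γ̃ = σ̃₁ / d̃_k`. The columns of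
this matrix are the released points, one for each element of `Z₂`. -/
noncomputable def noisyPoints (ε δ : ℝ) (k : ℕ) (G : SimpleGraph V) (s : Split V)
    (gap top : ℝ) (P : Fin (projDim V δ) → s.Y → ℝ) (N : Fin (projDim V δ) → s.Z₂ → ℝ) :
    Fin (projDim V δ) → s.Z₂ → ℝ :=
  fun i z =>
    (Matrix.of P * (topProj k (subAdj G s.Y s.Z₁) * subAdj G s.Y s.Z₂)) i z
      + 3 * k * (top / gap) / ε * √(2 * Real.log (5 / δ)) * N i z

/-- Everything computed from the data with noise added: the partition, `d̃_k`, `σ̃₁`, and then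
either `⊥` (the left summand) or the matrix `F̃`. -/
abbrev View (V : Type*) [Fintype V] [DecidableEq V] (δ : ℝ) : Type _ :=
  Σ s : Split V, ℝ × ℝ × (Unit ⊕ (Fin (projDim V δ) → s.Z₂ → ℝ))

/-- The output: `⊥` (the left summand), or the set `Z₂` with a point of `ℝ^m` for each of its
elements. -/
abbrev Output (V : Type*) [Fintype V] (δ : ℝ) : Type _ :=
  Unit ⊕ (Σ Z : Finset V, Fin (projDim V δ) → Z → ℝ)

open Classical in
/-- One run of the algorithm, as a function of the partition and the noise. -/
noncomputable def run (ε δ : ℝ) (k : ℕ) (G : SimpleGraph V) (s : Split V) (ω : Noise δ s) :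
    View V δ :=
  ⟨s, noisyGap ε δ k G s ω.1, noisyTop ε δ G s ω.2.1,
    if noisyGap ε δ k G s ω.1 ≤ 10 * (8 / ε * Real.log (4 / δ)) then Sum.inl ()
    else Sum.inr (noisyPoints ε δ k G s (noisyGap ε δ k G s ω.1) (noisyTop ε δ G s ω.2.1)
      ω.2.2.1 ω.2.2.2)⟩

/-- The law of the joint release of the partition, `d̃_k`, `σ̃₁` and `⊥` or `F̃`, where the partition
is uniformly random and independent of the noise. -/
noncomputable def releaseLaw (ε δ : ℝ) (k : ℕ) (G : SimpleGraph V) : Measure (View V δ) :=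
  (Fintype.card (Split V) : ENNReal)⁻¹ • ∑ s : Split V, (noiseLaw ε δ s).map (run ε δ k G s)

/-- What the algorithm returns: `⊥`, or `Z₂` and `F̃`. -/
def toOutput {δ : ℝ} (v : View V δ) : Output V δ :=
  Sum.map id (fun F => ⟨v.1.Z₂, F⟩) v.2.2.2

/-- The law of the output of the algorithm. -/
noncomputable def dpCommunity (ε δ : ℝ) (k : ℕ) (G : SimpleGraph V) : Measure (Output V δ) :=
  (releaseLaw ε δ k G).map toOutput

end Algorithm

/-! ### These are probability laws -/

section Sanity

variable {V : Type*} [Fintype V] [DecidableEq V]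

theorem isProbabilityMeasure_laplace {b : ℝ} (hb : 0 < b) : IsProbabilityMeasure (laplace b) := by
  have h1 : ∫ x in Set.Ioi (0 : ℝ), Real.exp (-x / b) = b := by
    have h := integral_comp_mul_left_Ioi (fun x => Real.exp (-x)) (0 : ℝ) (inv_pos.2 hb)
    simp only [mul_zero, integral_exp_neg_Ioi_zero, inv_inv, smul_eq_mul, mul_one] at h
    refine Eq.trans (integral_congr_ae (Filter.Eventually.of_forall fun x => ?_)) h
    simp only
    congr 1
    rw [neg_div, div_eq_inv_mul]
  have h2 : ∫ x : ℝ, Real.exp (-|x| / b) / (2 * b) = 1 := by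
    rw [integral_div, integral_comp_abs (f := fun x => Real.exp (-x / b)), h1]
    field_simp
  refine ⟨?_⟩
  rw [laplace, withDensity_apply _ MeasurableSet.univ, Measure.restrict_univ,
    ← ofReal_integral_eq_lintegral_ofReal, h2, ENNReal.ofReal_one]
  · by_contra hni
    rw [integral_undef hni] at h2
    exact zero_ne_one h2
  · exact Filter.Eventually.of_forall fun x => by positivity

instance (a b : Type*) [Fintype a] [Fintype b] (s : ℝ) :
    IsProbabilityMeasure (gaussianMatrix a b s) := by
  unfold gaussianMatrix
  infer_instance

theorem isProbabilityMeasure_noiseLaw {ε : ℝ} (hε : 0 < ε) (δ : ℝ) (s : Split V) :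
    IsProbabilityMeasure (noiseLaw ε δ s) := by
  have h1 := isProbabilityMeasure_laplace (b := 8 / ε) (by positivity)
  have h2 := isProbabilityMeasure_laplace (b := 4 / ε) (by positivity)
  unfold noiseLaw
  infer_instance

theorem measurable_mk {α : Type*} {β : α → Type*} [∀ a, MeasurableSpace (β a)] (a : α) :
    Measurable (Sigma.mk a : β a → Sigma β) :=
  Measurable.of_le_map (iInf_le _ a)

theorem measurable_run (ε δ : ℝ) (k : ℕ) (G : SimpleGraph V) (s : Split V) :
    Measurable (run ε δ k G s) := by
  classical
  have hg : Measurable fun ω : Noise δ s => noisyGap ε δ k G s ω.1 := by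
    unfold noisyGap; fun_prop
  have ht : Measurable fun ω : Noise δ s => noisyTop ε δ G s ω.2.1 := by
    unfold noisyTop; fun_prop
  refine (measurable_mk s).comp (hg.prodMk (ht.prodMk ?_))
  refine Measurable.ite (measurableSet_le hg measurable_const) measurable_const ?_
  refine measurable_inr.comp (measurable_pi_lambda _ fun i => measurable_pi_lambda _ fun z => ?_)
  have hP : ∀ y, Measurable fun ω : Noise δ s => ω.2.2.1 i y := fun y => by fun_prop
  have hN : Measurable fun ω : Noise δ s => ω.2.2.2 i z := by fun_prop
  simp only [noisyPoints, Matrix.mul_apply (M := Matrix.of _), Matrix.of_apply]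
  exact (Finset.measurable_sum _ fun y _ => (hP y).mul_const _).add
    (((((ht.div hg).const_mul _).div_const _).mul_const _).mul hN)

theorem measurable_toOutput (δ : ℝ) : Measurable (toOutput : View V δ → Output V δ) := by
  intro t ht
  refine MeasurableSpace.measurableSet_iInf.2 fun s => ?_
  have h : Measurable fun v : ℝ × ℝ × (Unit ⊕ (Fin (projDim V δ) → s.Z₂ → ℝ)) =>
      (toOutput (⟨s, v⟩ : View V δ) : Output V δ) := by
    have hm : Measurable (fun F => ⟨s.Z₂, F⟩ :
        (Fin (projDim V δ) → s.Z₂ → ℝ) → Σ Z : Finset V, Fin (projDim V δ) → Z → ℝ) :=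
      measurable_mk s.Z₂
    exact (Measurable.sumMap measurable_id hm).comp (measurable_snd.comp measurable_snd)
  exact h ht

theorem nonempty_split (hV : 4 ∣ Fintype.card V) : Nonempty (Split V) := by
  obtain ⟨q, hq⟩ := hV
  obtain ⟨Y, -, hY⟩ := Finset.exists_subset_card_eq (s := (Finset.univ : Finset V)) (n := 2 * q)
    (by rw [Finset.card_univ]; omega)
  have hYc : Yᶜ.card = 2 * q := by rw [Finset.card_compl]; omega
  obtain ⟨Z, hZY, hZ⟩ := Finset.exists_subset_card_eq (s := Yᶜ) (n := q) (by omega)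
  have hd : Disjoint Y Z := Finset.disjoint_left.2 fun x hx hz => by
    simpa [hx] using hZY hz
  have hc : (Y ∪ Z)ᶜ.card = q := by
    rw [Finset.card_compl, Finset.card_union_of_disjoint hd]; omega
  refine ⟨⟨(Y, Z, (Y ∪ Z)ᶜ), hd, ?_, ?_, ?_, ?_, ?_, ?_⟩⟩
  · exact disjoint_compl_right.mono_left Finset.subset_union_left
  · exact disjoint_compl_right.mono_left Finset.subset_union_right
  · exact Finset.union_compl _
  · simp only [hY]; omega
  · simp only [hZ]; omega
  · simp only [hc]; omega

theorem isProbabilityMeasure_releaseLaw (hV : 4 ∣ Fintype.card V) {ε : ℝ} (hε : 0 < ε) (δ : ℝ)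
    (k : ℕ) (G : SimpleGraph V) : IsProbabilityMeasure (releaseLaw ε δ k G) := by
  have := nonempty_split hV
  have hp : ∀ s : Split V, ((noiseLaw ε δ s).map (run ε δ k G s)) Set.univ = 1 := fun s => by
    have := isProbabilityMeasure_noiseLaw hε δ s
    rw [Measure.map_apply (measurable_run ε δ k G s) MeasurableSet.univ, Set.preimage_univ,
      measure_univ]
  refine ⟨?_⟩
  simp only [releaseLaw, Measure.smul_apply, Measure.finsetSum_apply, hp, Finset.sum_const,
    Finset.card_univ, smul_eq_mul, nsmul_eq_mul, mul_one]
  exact ENNReal.inv_mul_cancel (by simp) (by simp)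

theorem isProbabilityMeasure_dpCommunity (hV : 4 ∣ Fintype.card V) {ε : ℝ} (hε : 0 < ε) (δ : ℝ)
    (k : ℕ) (G : SimpleGraph V) : IsProbabilityMeasure (dpCommunity ε δ k G) := by
  have := isProbabilityMeasure_releaseLaw hV hε δ k G
  exact Measure.isProbabilityMeasure_map (measurable_toOutput δ).aemeasurable

end Sanity

end DPComm

set_option linter.unusedSectionVars false

/-! Condition on the partition. Since `Y`, `Z₁`, `Z₂` are disjoint, one edge alters at most one
entry of at most one of Â₁, Â₂ (`split_subAdj_cases`). By Weyl's inequality either the gap moves by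
at most 2 or σ₁ moves by at most 1, so the two Laplace values cost a factor e^{ε/4}, and e^{3ε/4} is
left for the Gaussian mechanism. Given the same released values t of d̃_k and w of σ̃₁ and the same
P, either both graphs return ⊥ or both return a Gaussian perturbation of P Π Â₂
(`condProb_le_of_good`). With high probability P enlarges the Frobenius norm by at most √2
(`gaussianMatrix_norm_mul_tail`), so it suffices that √2 ‖Π Â₂ - Π' Â₂'‖_F ≤ (9/4) k w / t. Outside
a Laplace tail, t lies below the true gap d.

If Â₁ changes, Wedin's theorem gives ‖Π - Π'‖_F ≤ √2 / (d - 1). The left side above is then at most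
2 σ₁ / (d - 1), which is small enough once w ≥ σ₁, because the threshold forces t > 80
(`map_run_le_of_gap_change`).

If Â₂ changes in row y₀, the difference is a multiple of one column of Π. Its norm is at most √D₁ /
σ_k, where D₁ and D₂ count the neighbours of y₀ in `Z₁` and `Z₂` (`sum_sq_topProj_col_mul_le`). Now
w ≥ (2/3) √D₁ is needed, but the data only guarantee σ₁(Â₂) ≥ √D₂, and an unlucky partition may have
D₂ far below D₁. The failure probability is therefore not bounded uniformly in the partition. It is
at most (δ/8)(1 + (5/4)(3/2)^{D₁}(1/2)^{D₂}) by `exp_sqrt_sub_le`, and the last product has mean at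
most 1 over the random partition (`sum_split_nbrCount_le`). Averaging keeps the total additive error
below δ; the output itself is post-processing of the joint release. -/

namespace DPComm

/-! ### Min-max for singular values, Weyl's inequality, invariance under the adjoint. -/

section MinMax

open Module

variable {E F : Type*} [NormedAddCommGroup E] [InnerProductSpace ℝ E] [FiniteDimensional ℝ E]
  [NormedAddCommGroup F] [InnerProductSpace ℝ F] [FiniteDimensional ℝ F]

theorem norm_sq_apply_eq_sum_singularValues (T : E →ₗ[ℝ] F) (x : E) :
    ‖T x‖ ^ 2 = ∑ i : Fin (finrank ℝ E), T.singularValues i ^ 2 *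
      inner ℝ (T.isSymmetric_adjoint_comp_self.eigenvectorBasis rfl i) x ^ 2 := by
  set hT := T.isSymmetric_adjoint_comp_self with hTdef
  set b := hT.eigenvectorBasis rfl with hb
  have h1 : ‖T x‖ ^ 2 = inner ℝ x ((LinearMap.adjoint T ∘ₗ T) x) := by
    rw [LinearMap.comp_apply, LinearMap.adjoint_inner_right, real_inner_self_eq_norm_sq]
  rw [h1, ← b.sum_inner_mul_inner]
  refine Finset.sum_congr rfl fun i _ => ?_
  rw [← hT, hT.apply_eigenvectorBasis, T.sq_singularValues_fin rfl, ← hb, real_inner_comm (b i) x,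
    inner_smul_left]
  simp only [RCLike.ofReal_real_eq_id, id_eq, conj_trivial]
  ring

/-- The span of the first i + 1 right singular vectors works. -/
theorem exists_submodule_singularValues_mul_norm_le (T : E →ₗ[ℝ] F) {i : ℕ} (hi : i < finrank ℝ E) :
    ∃ W : Submodule ℝ E, finrank ℝ W = i + 1 ∧
      ∀ x ∈ W, T.singularValues i * ‖x‖ ≤ ‖T x‖ := by
  set hT := T.isSymmetric_adjoint_comp_self with hTdef
  set b := hT.eigenvectorBasis rfl with hb
  let e : Fin (i + 1) → Fin (finrank ℝ E) := Fin.castLE hi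
  have he : Function.Injective e := Fin.castLE_injective hi
  refine ⟨Submodule.span ℝ (Set.range (b ∘ e)), ?_, fun x hx => ?_⟩
  · rw [finrank_span_eq_card ((b.orthonormal.comp e he).linearIndependent), Fintype.card_fin]
  · have hz : ∀ j : Fin (finrank ℝ E), i < (j : ℕ) → inner ℝ (b j) x = 0 := by
      intro j hj
      induction hx using Submodule.span_induction with
      | mem x hx =>
        obtain ⟨l, rfl⟩ := hx
        refine b.orthonormal.2 fun h => ?_
        have := congrArg Fin.val h
        simp only [e, Fin.val_castLE] at this
        omega
      | zero => simp
      | add x y _ _ hx hy => rw [inner_add_right, hx, hy, add_zero]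
      | smul a x _ hx => rw [inner_smul_right, hx, mul_zero]
    refine le_of_sq_le_sq ?_ (norm_nonneg _)
    rw [norm_sq_apply_eq_sum_singularValues, mul_pow, ← b.sum_sq_norm_inner_right, Finset.mul_sum]
    refine Finset.sum_le_sum fun j _ => ?_
    rw [Real.norm_eq_abs, sq_abs]
    rcases le_or_gt (j : ℕ) i with h | h
    · have := T.singularValues_antitone h
      have := T.singularValues_nonneg i
      gcongr
    · rw [hz j h]; simp

/-- The span of the right singular vectors from index i on works; it is trivial when i reaches the
dimension. -/
theorem exists_submodule_norm_le_singularValues_mul (T : E →ₗ[ℝ] F) (i : ℕ) :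
    ∃ W : Submodule ℝ E, finrank ℝ E ≤ finrank ℝ W + i ∧
      ∀ x ∈ W, ‖T x‖ ≤ T.singularValues i * ‖x‖ := by
  rcases lt_or_ge i (finrank ℝ E) with hi | hi
  swap
  · exact ⟨⊥, by simpa using hi, by simp⟩
  set hT := T.isSymmetric_adjoint_comp_self with hTdef
  set b := hT.eigenvectorBasis rfl with hb
  let e : {j : Fin (finrank ℝ E) // i ≤ (j : ℕ)} → Fin (finrank ℝ E) := Subtype.val
  have he : Function.Injective e := Subtype.val_injective
  refine ⟨Submodule.span ℝ (Set.range (b ∘ e)), ?_, fun x hx => ?_⟩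
  · rw [finrank_span_eq_card ((b.orthonormal.comp e he).linearIndependent)]
    have h1 := Fintype.card_subtype_compl (fun j : Fin (finrank ℝ E) => (j : ℕ) < i)
    simp only [not_lt, Fintype.card_fin] at h1
    have h2 : Fintype.card {j : Fin (finrank ℝ E) // (j : ℕ) < i} ≤ i := by
      have := Fintype.card_le_of_injective
        (fun j : {j : Fin (finrank ℝ E) // (j : ℕ) < i} => (⟨j.1.1, j.2⟩ : Fin i))
        (fun a b h => Subtype.ext (Fin.ext (by simpa using h)))
      simpa using this
    omega
  · have hz : ∀ j : Fin (finrank ℝ E), (j : ℕ) < i → inner ℝ (b j) x = 0 := by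
      intro j hj
      induction hx using Submodule.span_induction with
      | mem x hx =>
        obtain ⟨l, rfl⟩ := hx
        refine b.orthonormal.2 fun h => ?_
        have := congrArg Fin.val h
        have := l.2
        simp only [e] at *
        omega
      | zero => simp
      | add x y _ _ hx hy => rw [inner_add_right, hx, hy, add_zero]
      | smul a x _ hx => rw [inner_smul_right, hx, mul_zero]
    refine le_of_sq_le_sq ?_ (mul_nonneg (T.singularValues_nonneg i) (norm_nonneg _))
    rw [norm_sq_apply_eq_sum_singularValues, mul_pow, ← b.sum_sq_norm_inner_right, Finset.mul_sum]
    refine Finset.sum_le_sum fun j _ => ?_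
    rw [Real.norm_eq_abs, sq_abs]
    rcases lt_or_ge (j : ℕ) i with h | h
    · rw [hz j h]; simp
    · have := T.singularValues_antitone h
      have := T.singularValues_nonneg j
      gcongr

/-- By dimension count, `W` meets the subspace of codimension at most i on which T stretches by at
most σ_i. -/
theorem le_singularValues_of_finrank_lt (T : E →ₗ[ℝ] F) {i : ℕ} {W : Submodule ℝ E}
    (hW : i < finrank ℝ W) {c : ℝ} (h : ∀ x ∈ W, c * ‖x‖ ≤ ‖T x‖) : c ≤ T.singularValues i := by
  obtain ⟨V, hV, hV'⟩ := exists_submodule_norm_le_singularValues_mul T i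
  have h1 := Submodule.finrank_sup_add_finrank_inf_eq W V
  have h2 := Submodule.finrank_le (W ⊔ V)
  have h3 : 0 < finrank ℝ (W ⊓ V : Submodule ℝ E) := by omega
  rw [Module.finrank_pos_iff_exists_ne_zero] at h3
  obtain ⟨⟨x, hxW, hxV⟩, hx⟩ := h3
  have hx0 : 0 < ‖x‖ := norm_pos_iff.2 fun h0 => hx (Subtype.ext h0)
  exact le_of_mul_le_mul_right ((h x hxW).trans (hV' x hxV)) hx0

/-- Weyl's inequality: on the subspace where T stretches by at least σ_i, T' stretches by at least
σ_i - c. -/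
theorem singularValues_le_singularValues_add (T T' : E →ₗ[ℝ] F) {c : ℝ} (hc : 0 ≤ c)
    (h : ∀ x, ‖T x - T' x‖ ≤ c * ‖x‖) (i : ℕ) :
    T.singularValues i ≤ T'.singularValues i + c := by
  rcases lt_or_ge i (finrank ℝ E) with hi | hi
  swap
  · rw [T.singularValues_of_finrank_le hi]
    exact add_nonneg (T'.singularValues_nonneg i) hc
  obtain ⟨W, hW, hW'⟩ := exists_submodule_singularValues_mul_norm_le T hi
  have := le_singularValues_of_finrank_lt T' (i := i) (W := W) (by omega)
    (c := T.singularValues i - c) fun x hx => by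
      have h1 := hW' x hx
      have h2 := norm_sub_norm_le (T x) (T' x)
      have h3 := h x
      linarith
  linarith

theorem norm_apply_le_singularValues_zero_mul (T : E →ₗ[ℝ] F) (x : E) :
    ‖T x‖ ≤ T.singularValues 0 * ‖x‖ := by
  obtain ⟨W, hW, hW'⟩ := exists_submodule_norm_le_singularValues_mul T 0
  have : W = ⊤ := Submodule.eq_top_of_finrank_eq (le_antisymm (Submodule.finrank_le W) hW)
  exact hW' x (this ▸ Submodule.mem_top)

/-- If σ_i > 0, T is injective on the (i+1)-dimensional space W it stretches by σ_i. On T(W) the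
adjoint stretches as much, since ‖Tx‖² = ⟨T*Tx, x⟩ ≤ ‖T*Tx‖ ‖x‖. The adjoint matters because left
singular vectors come from M Mᵀ while `sigma` is defined through M. -/
theorem singularValues_le_singularValues_adjoint (T : E →ₗ[ℝ] F) (i : ℕ) :
    T.singularValues i ≤ (LinearMap.adjoint T).singularValues i := by
  rcases (T.singularValues_nonneg i).eq_or_lt with h0 | h0
  · rw [← h0]; exact LinearMap.singularValues_nonneg _ i
  have hi : i < finrank ℝ E := by
    by_contra h
    rw [T.singularValues_of_finrank_le (not_lt.1 h)] at h0
    exact lt_irrefl _ h0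
  obtain ⟨W, hW, hW'⟩ := exists_submodule_singularValues_mul_norm_le T hi
  have hinj : Function.Injective (T.domRestrict W) := by
    rw [← LinearMap.ker_eq_bot, LinearMap.ker_eq_bot']
    intro x hx
    have h1 := hW' x x.2
    have h2 : T x = 0 := hx
    rw [h2, norm_zero] at h1
    have : ‖(x : E)‖ = 0 := by nlinarith [norm_nonneg (x : E)]
    exact Subtype.ext (norm_eq_zero.1 this)
  have hr := LinearMap.finrank_range_of_inj hinj
  refine le_singularValues_of_finrank_lt _ (W := LinearMap.range (T.domRestrict W)) (by omega) ?_
  rintro _ ⟨x, rfl⟩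
  change _ * ‖T x‖ ≤ ‖LinearMap.adjoint T (T x)‖
  rcases (norm_nonneg (x : E)).eq_or_lt with hx | hx
  · rw [norm_eq_zero.1 hx.symm]; simp
  have h1 := hW' x x.2
  have h2 : ‖T x‖ ^ 2 ≤ ‖LinearMap.adjoint T (T x)‖ * ‖(x : E)‖ := by
    rw [← real_inner_self_eq_norm_sq, ← LinearMap.adjoint_inner_left]
    exact real_inner_le_norm _ _
  refine le_of_mul_le_mul_right ?_ hx
  nlinarith [norm_nonneg (T x)]

theorem singularValues_adjoint (T : E →ₗ[ℝ] F) (i : ℕ) :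
    (LinearMap.adjoint T).singularValues i = T.singularValues i :=
  le_antisymm (by simpa using singularValues_le_singularValues_adjoint (LinearMap.adjoint T) i)
    (singularValues_le_singularValues_adjoint T i)

end MinMax

/-! ### Wedin's sin-theta theorem for a rank-one perturbation, in Frobenius norm. -/

section Wedin

variable {E F : Type*} [NormedAddCommGroup E] [InnerProductSpace ℝ E] [FiniteDimensional ℝ E]
  [NormedAddCommGroup F] [InnerProductSpace ℝ F] [FiniteDimensional ℝ F]

/-- Bessel's inequality for an orthonormal family padded with zeros; right singular vectors for a
zero singular value are taken to be zero below. -/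
theorem sum_inner_sq_le_of_orthogonal {ι : Type*} [Fintype ι] {v : ι → E}
    (h0 : Pairwise fun i j => inner ℝ (v i) (v j) = 0) (h1 : ∀ i, v i = 0 ∨ ‖v i‖ = 1) (x : E) :
    ∑ i, inner ℝ (v i) x ^ 2 ≤ ‖x‖ ^ 2 := by
  classical
  let w : {i // v i ≠ 0} → E := fun i => v i
  have hw : Orthonormal ℝ w := by
    refine ⟨fun i => (h1 i).resolve_left i.2, fun i j hij => h0 fun h => hij (Subtype.ext h)⟩
  have h2 := hw.sum_inner_products_le x (s := Finset.univ)
  simp only [Real.norm_eq_abs, sq_abs] at h2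
  have h3 := Finset.sum_subtype (F := inferInstance) (p := fun i => v i ≠ 0) (Finset.univ.filter fun i => v i ≠ 0)
    (by simp) (fun i => inner ℝ (v i) x ^ 2)
  refine le_trans (le_of_eq ?_) h2
  rw [← h3]
  exact (Finset.sum_filter_of_ne (p := fun i => v i ≠ 0) fun i _ hi h =>
    hi (by rw [h, inner_zero_left, zero_pow two_ne_zero])).symm

theorem exists_right_singular_vectors {ι : Type*} [Fintype ι] (T : E →ₗ[ℝ] F) {u : ι → F}
    (hu : Orthonormal ℝ u) {s : ι → ℝ} (hs : ∀ i, 0 ≤ s i)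
    (hTu : ∀ i, T (LinearMap.adjoint T (u i)) = s i ^ 2 • u i) :
    ∃ v : ι → E, (∀ x, ∑ i, inner ℝ (v i) x ^ 2 ≤ ‖x‖ ^ 2) ∧
      (∀ i, LinearMap.adjoint T (u i) = s i • v i) ∧ ∀ i, T (v i) = s i • u i := by
  have hin : ∀ i j, inner ℝ (LinearMap.adjoint T (u i)) (LinearMap.adjoint T (u j)) =
      s j ^ 2 * inner ℝ (u i) (u j) := fun i j => by
    rw [LinearMap.adjoint_inner_left, hTu, inner_smul_right]
  have hn : ∀ i, ‖LinearMap.adjoint T (u i)‖ = s i := fun i => by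
    have h := hin i i
    rw [real_inner_self_eq_norm_sq, real_inner_self_eq_norm_sq, hu.1, one_pow, mul_one] at h
    exact (pow_left_inj₀ (norm_nonneg _) (hs i) two_ne_zero).1 h
  have h0 : ∀ i, s i = 0 → LinearMap.adjoint T (u i) = 0 := fun i hi =>
    norm_eq_zero.1 ((hn i).trans hi)
  -- With 0⁻¹ = 0 this is the zero vector when s i = 0, which is consistent because T*(u i) vanishes
  -- there.
  refine ⟨fun i => (s i)⁻¹ • LinearMap.adjoint T (u i),
    sum_inner_sq_le_of_orthogonal (fun i j hij => ?_) (fun i => ?_), fun i => ?_, fun i => ?_⟩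
  · simp only [inner_smul_left, inner_smul_right, hin, hu.2 hij, mul_zero]
  · rcases (hs i).eq_or_lt with h | h
    · left; simp [← h]
    · right; rw [norm_smul, hn, Real.norm_eq_abs, abs_of_pos (inv_pos.2 h), inv_mul_cancel₀ h.ne']
  · rcases (hs i).eq_or_lt with h | h
    · simp only [h0 i h.symm, smul_zero]
    · rw [smul_smul, mul_inv_cancel₀ h.ne', one_smul]
  · rcases (hs i).eq_or_lt with h | h
    · simp [← h]
    · rw [map_smul, hTu, smul_smul]; congr 1; field_simp

/-- Monotonicity of the ℓ² norm followed by Minkowski's inequality. -/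
theorem mul_sqrt_sum_sq_le {ι : Type*} [Fintype ι] {x y a : ι → ℝ} {α β : ℝ} (hα : 0 ≤ α)
    (hβ : 0 ≤ β) (h : ∀ i, α * |x i| ≤ β * |y i| + |a i|) :
    α * √(∑ i, x i ^ 2) ≤ β * √(∑ i, y i ^ 2) + √(∑ i, a i ^ 2) := by
  have hx := Real.sq_sqrt (Finset.sum_nonneg fun i (_ : i ∈ Finset.univ) => sq_nonneg (x i))
  have hy := Real.sq_sqrt (Finset.sum_nonneg fun i (_ : i ∈ Finset.univ) => sq_nonneg (y i))
  have ha := Real.sq_sqrt (Finset.sum_nonneg fun i (_ : i ∈ Finset.univ) => sq_nonneg (a i))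
  have hya : ∑ i, |y i| * |a i| ≤ √(∑ i, y i ^ 2) * √(∑ i, a i ^ 2) := by
    have := Real.sum_mul_le_sqrt_mul_sqrt Finset.univ (fun i => |y i|) (fun i => |a i|)
    simpa only [sq_abs] using this
  refine le_of_sq_le_sq ?_ (by positivity)
  have h1 : ∑ i, (α * |x i|) ^ 2 ≤ ∑ i, (β * |y i| + |a i|) ^ 2 :=
    Finset.sum_le_sum fun i _ => pow_le_pow_left₀ (by positivity) (h i) 2
  have h2 : ∑ i, (α * |x i|) ^ 2 = α ^ 2 * ∑ i, x i ^ 2 := by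
    simp only [mul_pow, sq_abs, Finset.mul_sum]
  have h3 : ∑ i, (β * |y i| + |a i|) ^ 2 =
      β ^ 2 * ∑ i, y i ^ 2 + 2 * β * ∑ i, |y i| * |a i| + ∑ i, a i ^ 2 := by
    simp only [Finset.mul_sum, ← Finset.sum_add_distrib]
    refine Finset.sum_congr rfl fun i _ => ?_
    rw [← sq_abs (y i), ← sq_abs (a i)]; ring
  rw [mul_pow, hx, add_sq, mul_pow, hy, ha]
  nlinarith [mul_le_mul_of_nonneg_left hya hβ]

/-- With X = (⟨u_i, u'_j⟩) and Y = (⟨v_i, v'_j⟩), pairing T' - T with singular vectors couples the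
two arrays: s X = s' Y - A and s Y = s' X - B, where A and B come from the perturbation and have
Frobenius norm at most 1. Separation of s from s' then bounds X. -/
theorem wedin {ι κ : Type*} [Fintype ι] [Fintype κ] (T T' : E →ₗ[ℝ] F) {a : F} {b : E}
    (ha : ‖a‖ ≤ 1) (hb : ‖b‖ ≤ 1) (hE : ∀ x, T' x - T x = inner ℝ b x • a)
    {u : ι → F} (hu : Orthonormal ℝ u) {s : ι → ℝ} (hs : ∀ i, 0 ≤ s i)
    (hTu : ∀ i, T (LinearMap.adjoint T (u i)) = s i ^ 2 • u i)
    {u' : κ → F} (hu' : Orthonormal ℝ u') {s' : κ → ℝ} (hs' : ∀ i, 0 ≤ s' i)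
    (hTu' : ∀ i, T' (LinearMap.adjoint T' (u' i)) = s' i ^ 2 • u' i)
    {α β : ℝ} (hα : ∀ i, α ≤ s i) (hβ : ∀ j, s' j ≤ β) (hβ0 : 0 ≤ β) (hαβ : β < α) :
    ∑ p : ι × κ, inner ℝ (u p.1) (u' p.2) ^ 2 ≤ (1 / (α - β)) ^ 2 := by
  obtain ⟨v, hv, hTv, hvT⟩ := exists_right_singular_vectors T hu hs hTu
  obtain ⟨v', hv', hTv', hvT'⟩ := exists_right_singular_vectors T' hu' hs' hTu'
  have hub := fun x => sum_inner_sq_le_of_orthogonal hu.2 (fun i => Or.inr (hu.1 i)) x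
  have hub' := fun x => sum_inner_sq_le_of_orthogonal hu'.2 (fun i => Or.inr (hu'.1 i)) x
  have hb1 : ‖b‖ ^ 2 ≤ 1 := pow_le_one₀ (norm_nonneg _) hb
  have ha1 : ‖a‖ ^ 2 ≤ 1 := pow_le_one₀ (norm_nonneg _) ha
  set X : ι × κ → ℝ := fun p => inner ℝ (u p.1) (u' p.2) with hX
  set Y : ι × κ → ℝ := fun p => inner ℝ (v p.1) (v' p.2) with hY
  set A : ι × κ → ℝ := fun p => inner ℝ (v p.1) b * inner ℝ (u' p.2) a with hA
  set B : ι × κ → ℝ := fun p => inner ℝ (v' p.2) b * inner ℝ (u p.1) a with hB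
  have e1 : ∀ p : ι × κ, s p.1 * X p = s' p.2 * Y p - A p := by
    intro ⟨i, j⟩
    have h1 : inner ℝ (T' (v i) - T (v i)) (u' j) = A (i, j) := by
      rw [hE, inner_smul_left]
      simp [hA, real_inner_comm]
    rw [inner_sub_left, ← LinearMap.adjoint_inner_right, hTv', hvT, inner_smul_left,
      inner_smul_right] at h1
    simp only [hX, hY, conj_trivial] at h1 ⊢
    linarith
  have e2 : ∀ p : ι × κ, s p.1 * Y p = s' p.2 * X p - B p := by
    intro ⟨i, j⟩
    have h1 : inner ℝ (T' (v' j) - T (v' j)) (u i) = B (i, j) := by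
      rw [hE, inner_smul_left]
      simp [hB, real_inner_comm]
    rw [inner_sub_left, ← LinearMap.adjoint_inner_right T, hTv, hvT', inner_smul_left,
      inner_smul_right, real_inner_comm, real_inner_comm (v i)] at h1
    simp only [hX, hY, conj_trivial] at h1 ⊢
    linarith
  -- The perturbation has rank one, so the double sum factors and Bessel applies to each factor.
  have hA1 : √(∑ p, A p ^ 2) ≤ 1 := by
    rw [Real.sqrt_le_one]
    simp only [hA, mul_pow, Fintype.sum_prod_type, ← Finset.mul_sum, ← Finset.sum_mul]
    exact mul_le_one₀ ((hv b).trans hb1) (Finset.sum_nonneg fun _ _ => sq_nonneg _)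
      ((hub' a).trans ha1)
  have hB1 : √(∑ p, B p ^ 2) ≤ 1 := by
    rw [Real.sqrt_le_one]
    simp only [hB, mul_pow, Fintype.sum_prod_type_right, ← Finset.mul_sum, ← Finset.sum_mul]
    exact mul_le_one₀ ((hv' b).trans hb1) (Finset.sum_nonneg fun _ _ => sq_nonneg _)
      ((hub a).trans ha1)
  have key : ∀ Z W C : ι × κ → ℝ, (∀ p : ι × κ, s p.1 * Z p = s' p.2 * W p - C p) →
      ∀ p, α * |Z p| ≤ β * |W p| + |C p| := by
    intro Z W C h p
    have h1 : s p.1 * |Z p| ≤ s' p.2 * |W p| + |C p| := by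
      have h4 : s p.1 * |Z p| = |s p.1 * Z p| := by rw [abs_mul, abs_of_nonneg (hs p.1)]
      rw [h4, h p]
      refine (abs_sub _ _).trans ?_
      rw [abs_mul, abs_of_nonneg (hs' p.2)]
    have h2 := mul_le_mul_of_nonneg_right (hα p.1) (abs_nonneg (Z p))
    have h3 := mul_le_mul_of_nonneg_right (hβ p.2) (abs_nonneg (W p))
    linarith
  have hα0 : 0 ≤ α := hβ0.trans hαβ.le
  have f1 := mul_sqrt_sum_sq_le hα0 hβ0 (key X Y A e1)
  have f2 := mul_sqrt_sum_sq_le hα0 hβ0 (key Y X B e2)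
  have hpos : 0 < α - β := sub_pos.2 hαβ
  -- The inequality for the larger of ‖X‖, ‖Y‖ absorbs the other norm and bounds that larger one by
  -- 1 / (α - β).
  have hfin : √(∑ p, X p ^ 2) ≤ 1 / (α - β) := by
    rw [le_div_iff₀ hpos]
    rcases le_total (√(∑ p, Y p ^ 2)) (√(∑ p, X p ^ 2)) with h | h
    · nlinarith [mul_le_mul_of_nonneg_left h hβ0]
    · nlinarith [mul_le_mul_of_nonneg_left h hβ0, mul_le_mul_of_nonneg_left h hpos.le]
  exact (Real.sqrt_le_left (by positivity)).1 hfin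

end Wedin

/-! ### Frobenius estimates for spectral projections of matrices. -/

section MatrixSpectral

variable {m n p : Type*} [Fintype m] [DecidableEq m] [Fintype n] [DecidableEq n]
  [Fintype p] [DecidableEq p]

theorem sigma_nonneg (M : Matrix m n ℝ) (i : ℕ) : 0 ≤ sigma M i :=
  LinearMap.singularValues_nonneg _ _

theorem adjoint_toEuclideanLin (M : Matrix m n ℝ) :
    LinearMap.adjoint (Matrix.toEuclideanLin M) = Matrix.toEuclideanLin M.transpose := by
  rw [← Matrix.toEuclideanLin_conjTranspose_eq_adjoint, Matrix.conjTranspose_eq_transpose_of_trivial]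

theorem apply_adjoint_leftSingularBasis (M : Matrix m n ℝ) (i : Fin (Fintype.card m)) :
    Matrix.toEuclideanLin M (LinearMap.adjoint (Matrix.toEuclideanLin M) (leftSingularBasis M i)) =
      sigma M (i + 1) ^ 2 • leftSingularBasis M i := by
  set T := Matrix.toEuclideanLin M with hT
  have h1 := (LinearMap.isSymmetric_self_comp_adjoint T).apply_eigenvectorBasis
    finrank_euclideanSpace i
  have h2 := (LinearMap.adjoint T).sq_singularValues_fin finrank_euclideanSpace i
  rw [singularValues_adjoint] at h2
  simp only [LinearMap.adjoint_adjoint] at h2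
  rw [LinearMap.comp_apply] at h1
  change _ = T.singularValues (i + 1 - 1) ^ 2 • _
  rw [Nat.add_sub_cancel, h2]
  exact h1

theorem topProj_apply (k : ℕ) (M : Matrix m n ℝ) (y y' : m) :
    topProj k M y y' = ∑ i : {i : Fin (Fintype.card m) // (i : ℕ) < k},
      leftSingularBasis M i.1 y * leftSingularBasis M i.1 y' := by
  simp [topProj, Matrix.mul_apply, topLeft]

theorem sum_mul_leftSingularBasis (M M' : Matrix m n ℝ) (i j : Fin (Fintype.card m)) :
    ∑ y, leftSingularBasis M i y * leftSingularBasis M' j y =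
      inner ℝ (leftSingularBasis M i) (leftSingularBasis M' j) := by
  simp only [PiLp.inner_apply, RCLike.inner_apply, conj_trivial]
  exact Finset.sum_congr rfl fun _ _ => mul_comm _ _

/-- This is tr(Π Π') in terms of the angles between the two families of singular vectors. -/
theorem sum_topProj_mul_topProj (k : ℕ) (M M' : Matrix m n ℝ) :
    ∑ y, ∑ y', topProj k M y y' * topProj k M' y y' =
      ∑ i : {i : Fin (Fintype.card m) // (i : ℕ) < k},
        ∑ j : {i : Fin (Fintype.card m) // (i : ℕ) < k},
          inner ℝ (leftSingularBasis M i.1) (leftSingularBasis M' j.1) ^ 2 := by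
  simp only [← sum_mul_leftSingularBasis, sq, topProj_apply, Finset.sum_mul_sum]
  rw [Finset.sum_congr rfl fun y _ => Finset.sum_comm, Finset.sum_comm]
  refine Finset.sum_congr rfl fun i _ => ?_
  rw [Finset.sum_congr rfl fun y _ => Finset.sum_comm, Finset.sum_comm]
  refine Finset.sum_congr rfl fun j _ => Finset.sum_congr rfl fun y _ =>
    Finset.sum_congr rfl fun y' _ => ?_
  ring

theorem sum_sum_inner_sq_eq_card {ι H : Type*} [Fintype ι] [NormedAddCommGroup H]
    [InnerProductSpace ℝ H] (b b' : OrthonormalBasis ι ℝ H) (q : ι → Prop) [DecidablePred q] :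
    (∑ i : {i // q i}, ∑ j : {j // q j}, inner ℝ (b i.1) (b' j.1) ^ 2) +
      ∑ i : {i // q i}, ∑ j : {j // ¬ q j}, inner ℝ (b i.1) (b' j.1) ^ 2 =
      Fintype.card {i // q i} := by
  have h1 : ∀ i, ∑ j, inner ℝ (b i) (b' j) ^ 2 = 1 := fun i => by
    have := b'.sum_sq_norm_inner_left (b i)
    simpa [b.orthonormal.1 i] using this
  have h2 : ∀ i, (∑ j : {j // q j}, inner ℝ (b i) (b' j.1) ^ 2) +
      ∑ j : {j // ¬ q j}, inner ℝ (b i) (b' j.1) ^ 2 = 1 := fun i =>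
    (Fintype.sum_subtype_add_sum_subtype q fun j => inner ℝ (b i) (b' j) ^ 2).trans (h1 i)
  rw [← Finset.sum_add_distrib, Finset.sum_congr rfl fun i _ => h2 i.1]
  simp

/-- Both projections have the same rank r, so ‖Π - Π'‖² = 2(r - tr Π Π'). By Parseval, r - tr Π Π'
is the mass that the top vectors of M put on the bottom vectors of M', the quantity Wedin's theorem
controls. -/
theorem sum_sq_topProj_sub_topProj (k : ℕ) (M M' : Matrix m n ℝ) :
    ∑ y, ∑ y', (topProj k M y y' - topProj k M' y y') ^ 2 =
      2 * ∑ p : {i : Fin (Fintype.card m) // (i : ℕ) < k} ×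
          {i : Fin (Fintype.card m) // ¬ (i : ℕ) < k},
        inner ℝ (leftSingularBasis M p.1.1) (leftSingularBasis M' p.2.1) ^ 2 := by
  have hself : ∀ N : Matrix m n ℝ, ∑ y, ∑ y', topProj k N y y' * topProj k N y y' =
      Fintype.card {i : Fin (Fintype.card m) // (i : ℕ) < k} := fun N => by
    simp [sum_topProj_mul_topProj, orthonormal_iff_ite.1 (leftSingularBasis N).orthonormal,
      Subtype.val_inj]
  have hsplit := sum_sum_inner_sq_eq_card (leftSingularBasis M) (leftSingularBasis M')
    fun i => (i : ℕ) < k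
  rw [← sum_topProj_mul_topProj] at hsplit
  rw [Fintype.sum_prod_type]
  have h1 := hself M
  have h2 := hself M'
  have h3 : ∀ a b : Matrix m m ℝ, ∑ y, ∑ y', (a y y' - b y y') ^ 2 =
      ∑ y, ∑ y', a y y' * a y y' - 2 * ∑ y, ∑ y', a y y' * b y y' +
        ∑ y, ∑ y', b y y' * b y y' := fun a b => by
    simp only [Finset.mul_sum, ← Finset.sum_sub_distrib, ← Finset.sum_add_distrib]
    exact Finset.sum_congr rfl fun _ _ => Finset.sum_congr rfl fun _ _ => by ring
  refine (h3 (topProj k M) (topProj k M')).trans ?_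
  rw [h1, h2, ← hsplit]
  ring

theorem sum_sq_mul_le (X : Matrix p m ℝ) (B : Matrix m n ℝ) :
    ∑ i, ∑ z, (X * B) i z ^ 2 ≤ (∑ i, ∑ y, X i y ^ 2) * sigma B 1 ^ 2 := by
  rw [Finset.sum_mul]
  refine Finset.sum_le_sum fun i _ => ?_
  have h := norm_apply_le_singularValues_zero_mul (LinearMap.adjoint (Matrix.toEuclideanLin B))
    (WithLp.toLp 2 (X i))
  rw [singularValues_adjoint, adjoint_toEuclideanLin] at h
  have h2 := pow_le_pow_left₀ (norm_nonneg _) h 2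
  rw [mul_pow, EuclideanSpace.norm_sq_eq, EuclideanSpace.norm_sq_eq] at h2
  simp only [Real.norm_eq_abs, sq_abs] at h2
  rw [mul_comm]
  refine le_trans (le_of_eq (Finset.sum_congr rfl fun z _ => ?_)) h2
  simp [Matrix.mul_apply, Matrix.toLpLin_apply, Matrix.mulVec, dotProduct, mul_comm]

theorem sum_sq_row_le (M : Matrix m n ℝ) (y : m) : ∑ z, M y z ^ 2 ≤ sigma M 1 ^ 2 := by
  have h := sum_sq_mul_le (Matrix.of fun (_ : Unit) y' => if y' = y then (1 : ℝ) else 0) M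
  simpa [Matrix.mul_apply] using h

/-- The column has squared norm Σ u_i(y)². Since ⟨v_i, Mᵀe_y⟩ = s_i u_i(y), Bessel bounds Σ s_i²
u_i(y)² by the squared norm of row y, and s_i ≥ σ_k. Hence a vertex of low degree into the columns
is nearly orthogonal to the top space when σ_k is large. -/
theorem sum_sq_topProj_col_mul_le {k : ℕ} (hk : 1 ≤ k) (M : Matrix m n ℝ) (y : m) :
    (∑ y', topProj k M y' y ^ 2) * sigma M k ^ 2 ≤ ∑ z, M y z ^ 2 := by
  set u := fun i : {i : Fin (Fintype.card m) // (i : ℕ) < k} => leftSingularBasis M i.1 with hu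
  have huo : Orthonormal ℝ u := (leftSingularBasis M).orthonormal.comp _ Subtype.val_injective
  have h1 : ∑ y', topProj k M y' y ^ 2 = ∑ i, u i y ^ 2 := by
    have h := huo.inner_sum (fun i => u i y) (fun i => u i y) Finset.univ
    rw [real_inner_self_eq_norm_sq, EuclideanSpace.norm_sq_eq] at h
    simp only [Real.norm_eq_abs, sq_abs, conj_trivial, ← sq] at h
    rw [← h]
    refine Finset.sum_congr rfl fun y' _ => ?_
    rw [topProj_apply]
    simp [hu, mul_comm]
  obtain ⟨v, hv, -, hvT⟩ := exists_right_singular_vectors (Matrix.toEuclideanLin M) huo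
    (s := fun i => sigma M (i.1 + 1)) (fun i => sigma_nonneg _ _)
    (fun i => apply_adjoint_leftSingularBasis M i.1)
  have h2 := hv (LinearMap.adjoint (Matrix.toEuclideanLin M) (EuclideanSpace.single y 1))
  simp only [LinearMap.adjoint_inner_right, hvT] at h2
  rw [adjoint_toEuclideanLin, EuclideanSpace.norm_sq_eq] at h2
  have h3 : ∑ z, ‖(Matrix.toEuclideanLin M.transpose (EuclideanSpace.single y 1)) z‖ ^ 2 =
      ∑ z, M y z ^ 2 := by
    simp [Matrix.toLpLin_apply]
  rw [h3] at h2
  refine le_trans ?_ h2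
  rw [h1, Finset.sum_mul]
  refine Finset.sum_le_sum fun i _ => ?_
  have h4 : sigma M k ≤ sigma M (i.1 + 1) := LinearMap.singularValues_antitone _ (by
    have := i.2; omega)
  have h5 : inner ℝ (sigma M (i.1 + 1) • u i) (EuclideanSpace.single y (1 : ℝ)) =
      sigma M (i.1 + 1) * u i y := by
    rw [real_inner_smul_left, EuclideanSpace.inner_single_right]
    simp
  rw [h5, mul_pow, mul_comm]
  have := sigma_nonneg M k
  gcongr

/-- `M'` is `M` plus `c` times the matrix unit at `(y₀, z₀)`. -/
theorem toEuclideanLin_sub_of_single {M M' : Matrix m n ℝ} {y₀ : m} {z₀ : n} {c : ℝ}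
    (h : ∀ y z, M' y z = M y z + if y = y₀ ∧ z = z₀ then c else 0) (x : EuclideanSpace ℝ n) :
    Matrix.toEuclideanLin M' x - Matrix.toEuclideanLin M x =
      inner ℝ (EuclideanSpace.single z₀ (1 : ℝ)) x • EuclideanSpace.single y₀ c := by
  ext y
  by_cases hy : y = y₀ <;>
  simp [Matrix.toLpLin_apply, Matrix.mulVec, dotProduct, h, add_mul, Finset.sum_add_distrib, hy,
    EuclideanSpace.inner_single_left, mul_comm]

theorem sigma_le_sigma_add {M M' : Matrix m n ℝ} {y₀ : m} {z₀ : n} {c : ℝ} (hc : |c| ≤ 1)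
    (h : ∀ y z, M' y z = M y z + if y = y₀ ∧ z = z₀ then c else 0) (i : ℕ) :
    sigma M' i ≤ sigma M i + 1 := by
  refine singularValues_le_singularValues_add _ _ zero_le_one (fun x => ?_) _
  rw [toEuclideanLin_sub_of_single h, norm_smul, one_mul, PiLp.norm_single]
  have h1 := norm_inner_le_norm (𝕜 := ℝ) (EuclideanSpace.single z₀ (1 : ℝ)) x
  rw [PiLp.norm_single, norm_one, one_mul] at h1
  exact (mul_le_mul h1 hc (abs_nonneg _) (norm_nonneg _)).trans (mul_one _).le

theorem sum_sq_topProj_sub_le {M M' : Matrix m n ℝ} {y₀ : m} {z₀ : n} {c : ℝ} (hc : |c| ≤ 1)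
    (h : ∀ y z, M' y z = M y z + if y = y₀ ∧ z = z₀ then c else 0) {k : ℕ} (hk : 1 ≤ k)
    (hd : 1 < sigma M k - sigma M (k + 1)) :
    ∑ y, ∑ y', (topProj k M y y' - topProj k M' y y') ^ 2 ≤
      2 * (1 / (sigma M k - sigma M (k + 1) - 1)) ^ 2 := by
  rw [sum_sq_topProj_sub_topProj]
  refine mul_le_mul_of_nonneg_left ?_ zero_le_two
  have hle := sigma_le_sigma_add hc h (k + 1)
  have ha : Antitone fun i => sigma M (i + 1) := fun i j hij =>
    LinearMap.singularValues_antitone _ (by simpa using hij)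
  have ha' : Antitone fun i => sigma M' (i + 1) := fun i j hij =>
    LinearMap.singularValues_antitone _ (by simpa using hij)
  have hw := wedin (Matrix.toEuclideanLin M) (Matrix.toEuclideanLin M')
    (a := EuclideanSpace.single y₀ c) (b := EuclideanSpace.single z₀ (1 : ℝ))
    (by rw [PiLp.norm_single]; exact hc) (by rw [PiLp.norm_single, norm_one])
    (toEuclideanLin_sub_of_single h)
    (u := fun i : {i : Fin (Fintype.card m) // (i : ℕ) < k} => leftSingularBasis M i.1)
    ((leftSingularBasis M).orthonormal.comp _ Subtype.val_injective)
    (s := fun i => sigma M (i.1 + 1)) (fun i => sigma_nonneg _ _)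
    (fun i => apply_adjoint_leftSingularBasis M i.1)
    (u' := fun i : {i : Fin (Fintype.card m) // ¬ (i : ℕ) < k} => leftSingularBasis M' i.1)
    ((leftSingularBasis M').orthonormal.comp _ Subtype.val_injective)
    (s' := fun i => sigma M' (i.1 + 1)) (fun i => sigma_nonneg _ _)
    (fun i => apply_adjoint_leftSingularBasis M' i.1)
    -- Weyl's inequality bounds the lower singular values of M' by this β, so only the gap of M
    -- enters.
    (α := sigma M k) (β := sigma M (k + 1) + 1)
    (fun i => by
      have := ha (a := (i.1 : ℕ)) (b := k - 1) (by have := i.2; omega)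
      simpa [Nat.sub_add_cancel hk] using this)
    (fun i => (ha' (a := k) (b := (i.1 : ℕ)) (not_lt.1 i.2)).trans hle)
    (add_nonneg (sigma_nonneg _ _) zero_le_one) (by linarith)
  rwa [← sub_sub] at hw

end MatrixSpectral

/-! ### An exponential moment of neighbour counts over the random partition. -/

section Balanced

variable {α : Type*} [DecidableEq α]

/-- Double counting of triples `(A, i, j)` with `i ∈ A`, `j ∉ A`. -/
theorem sum_powersetCard_succ_eq (Z : Finset α) (q : ℕ) (hZ : Z.card = 2 * (q + 1))
    (x y : α → ℝ) :
    ((q : ℝ) + 1) ^ 2 * ∑ A ∈ Z.powersetCard (q + 1), (∏ i ∈ A, x i) * ∏ i ∈ Z \ A, y i =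
      ∑ p ∈ Z.offDiag, x p.1 * y p.2 *
        ∑ A ∈ ((Z.erase p.1).erase p.2).powersetCard q,
          (∏ i ∈ A, x i) * ∏ i ∈ ((Z.erase p.1).erase p.2) \ A, y i := by
  have h1 : ∀ A ∈ Z.powersetCard (q + 1), ((q : ℝ) + 1) ^ 2 *
      ((∏ i ∈ A, x i) * ∏ i ∈ Z \ A, y i) =
      ∑ p ∈ A ×ˢ (Z \ A), (∏ i ∈ A, x i) * ∏ i ∈ Z \ A, y i := fun A hA => by
    rw [Finset.mem_powersetCard] at hA
    rw [Finset.sum_const, Finset.card_product, Finset.card_sdiff_of_subset hA.1, hA.2, hZ,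
      nsmul_eq_mul, show 2 * (q + 1) - (q + 1) = q + 1 by omega]
    push_cast
    ring
  rw [Finset.mul_sum, Finset.sum_congr rfl h1]
  simp only [Finset.mul_sum]
  rw [Finset.sum_sigma', Finset.sum_sigma']
  -- The triple (A, i, j) corresponds to the ordered pair (i, j) together with A without i.
  refine Finset.sum_bij' (fun a _ => ⟨a.2, a.1.erase a.2.1⟩) (fun b _ => ⟨insert b.1.1 b.2, b.1⟩)
    ?_ ?_ ?_ ?_ ?_
  · rintro ⟨A, i, j⟩ h
    simp only [Finset.mem_sigma, Finset.mem_powersetCard, Finset.mem_product, Finset.mem_sdiff,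
      Finset.mem_offDiag] at h ⊢
    obtain ⟨⟨hA, hAc⟩, hi, hj, hjA⟩ := h
    refine ⟨⟨hA hi, hj, fun h => hjA (h ▸ hi)⟩, fun a ha => ?_, ?_⟩
    · simp only [Finset.mem_erase] at ha ⊢
      exact ⟨fun h => hjA (h ▸ ha.2), ha.1, hA ha.2⟩
    · rw [Finset.card_erase_of_mem hi]; omega
  · rintro ⟨⟨i, j⟩, A⟩ h
    simp only [Finset.mem_sigma, Finset.mem_powersetCard, Finset.mem_product, Finset.mem_sdiff,
      Finset.mem_offDiag] at h ⊢
    obtain ⟨⟨hi, hj, hij⟩, hA, hAc⟩ := h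
    have hiA : i ∉ A := fun h => by simpa using hA h
    have hjA : j ∉ A := fun h => by simpa using hA h
    refine ⟨⟨fun a ha => ?_, ?_⟩, Finset.mem_insert_self _ _, hj, ?_⟩
    · rcases Finset.mem_insert.1 ha with rfl | ha
      · exact hi
      · exact Finset.mem_of_mem_erase (Finset.mem_of_mem_erase (hA ha))
    · rw [Finset.card_insert_of_notMem hiA]; omega
    · simp [hjA, Ne.symm hij]
  · rintro ⟨A, i, j⟩ h
    simp only [Finset.mem_sigma, Finset.mem_powersetCard, Finset.mem_product, Finset.mem_sdiff] at h ⊢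
    simp [Finset.insert_erase h.2.1]
  · rintro ⟨⟨i, j⟩, A⟩ h
    simp only [Finset.mem_sigma, Finset.mem_powersetCard,
      Finset.mem_offDiag] at h ⊢
    have hiA : i ∉ A := fun h' => by simpa using h.2.1 h'
    simp [Finset.erase_insert hiA]
  · rintro ⟨A, i, j⟩ h
    simp only [Finset.mem_sigma, Finset.mem_powersetCard, Finset.mem_product, Finset.mem_sdiff] at h ⊢
    obtain ⟨⟨hA, hAc⟩, hi, hj, hjA⟩ := h
    have h2 : ((Z.erase i).erase j) \ A.erase i = (Z \ A).erase j := by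
      ext a
      simp only [Finset.mem_sdiff, Finset.mem_erase]
      constructor
      · rintro ⟨⟨h1, h2, h3⟩, h4⟩
        exact ⟨h1, h3, fun h => h4 ⟨h2, h⟩⟩
      · rintro ⟨h1, h2, h3⟩
        exact ⟨⟨h1, fun h => h3 (h ▸ hi), h2⟩, fun h => h3 h.2⟩
    rw [h2, ← Finset.mul_prod_erase A x hi,
      ← Finset.mul_prod_erase (Z \ A) y (Finset.mem_sdiff.2 ⟨hj, hjA⟩)]
    ring

/-- Induction on q: in the double-counting identity the remaining sum is symmetric in i and j, so
x_i y_j may be replaced by its symmetrization, which is at most 1. The same identity with x = y = 1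
evaluates the resulting count. -/
theorem sum_powersetCard_prod_le (q : ℕ) (Z : Finset α) (hZ : Z.card = 2 * q) (x y : α → ℝ)
    (hx : ∀ i, 0 ≤ x i) (hy : ∀ i, 0 ≤ y i) (hxy : ∀ i j, i ≠ j → x i * y j + x j * y i ≤ 2) :
    ∑ A ∈ Z.powersetCard q, (∏ i ∈ A, x i) * ∏ i ∈ Z \ A, y i ≤ (2 * q).choose q := by
  induction q generalizing Z with
  | zero =>
    have : Z = ∅ := Finset.card_eq_zero.1 (by simpa using hZ)
    simp [this]
  | succ q ih =>
    set S : α → α → ℝ := fun i j => ∑ A ∈ ((Z.erase i).erase j).powersetCard q,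
          (∏ i ∈ A, x i) * ∏ i ∈ ((Z.erase i).erase j) \ A, y i with hS
    have hcard : ∀ p ∈ Z.offDiag, ((Z.erase p.1).erase p.2).card = 2 * q := fun p hp => by
      rw [Finset.mem_offDiag] at hp
      rw [Finset.card_erase_of_mem (Finset.mem_erase.2 ⟨hp.2.2.symm, hp.2.1⟩),
        Finset.card_erase_of_mem hp.1]
      omega
    have h1 := sum_powersetCard_succ_eq Z q hZ x y
    have h2 := sum_powersetCard_succ_eq Z q hZ (fun _ => 1) (fun _ => 1)
    simp only [Finset.prod_const_one, mul_one, Finset.sum_const, Finset.card_powersetCard, hZ,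
      nsmul_eq_mul, one_mul] at h2
    rw [Finset.sum_congr rfl fun p hp => by rw [hcard p hp]] at h2
    have hsymm : ∑ p ∈ Z.offDiag, x p.1 * y p.2 * S p.1 p.2 =
        ∑ p ∈ Z.offDiag, x p.2 * y p.1 * S p.1 p.2 := by
      refine Finset.sum_bij' (fun p _ => p.swap) (fun p _ => p.swap) ?_ ?_ ?_ ?_ ?_
      · simp only [Finset.mem_offDiag]; rintro ⟨i, j⟩ ⟨h1, h2, h3⟩; exact ⟨h2, h1, h3.symm⟩
      · simp only [Finset.mem_offDiag]; rintro ⟨i, j⟩ ⟨h1, h2, h3⟩; exact ⟨h2, h1, h3.symm⟩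
      · simp
      · simp
      · rintro ⟨i, j⟩ -
        simp only [hS, Prod.swap, Finset.erase_right_comm]
    have h3 : ∑ p ∈ Z.offDiag, x p.1 * y p.2 * S p.1 p.2 ≤
        ∑ p ∈ Z.offDiag, ((2 * q).choose q : ℝ) := by
      have : ∑ p ∈ Z.offDiag, (x p.1 * y p.2 * S p.1 p.2 + x p.2 * y p.1 * S p.1 p.2) ≤
          ∑ p ∈ Z.offDiag, 2 * ((2 * q).choose q : ℝ) := by
        refine Finset.sum_le_sum fun p hp => ?_
        have h4 : S p.1 p.2 ≤ (2 * q).choose q := ih _ (hcard p hp)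
        have h5 : 0 ≤ S p.1 p.2 := Finset.sum_nonneg fun A _ =>
          mul_nonneg (Finset.prod_nonneg fun i _ => hx i) (Finset.prod_nonneg fun i _ => hy i)
        have h6 := hxy p.1 p.2 (Finset.mem_offDiag.1 hp).2.2
        nlinarith
      rw [Finset.sum_add_distrib, ← hsymm, ← Finset.mul_sum] at this
      linarith
    rw [← h1] at h3
    rw [← h2] at h3
    exact le_of_mul_le_mul_left h3 (by positivity)

/-- The number of neighbours of `u` in `R`. -/
noncomputable def nbrCount {V : Type*} (G : SimpleGraph V) (u : V) (R : Finset V) : ℕ := by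
  classical exact (R.filter fun z => G.Adj u z).card

theorem Split.Z₁_subset {V : Type*} [Fintype V] [DecidableEq V] (s : Split V) : s.Z₁ ⊆ s.Yᶜ :=
  fun _ hz => Finset.mem_compl.2 fun hy => Finset.disjoint_left.1 s.2.1 hy hz

theorem Split.Z₂_eq {V : Type*} [Fintype V] [DecidableEq V] (s : Split V) :
    s.Z₂ = s.Yᶜ \ s.Z₁ := by
  obtain ⟨⟨Y, Z₁, Z₂⟩, h1, h2, h3, h4, -⟩ := s
  simp only [Split.Y, Split.Z₁, Split.Z₂] at *
  ext a
  have h5 : a ∈ Y ∪ Z₁ ∪ Z₂ := h4 ▸ Finset.mem_univ a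
  simp only [Finset.mem_union] at h5
  simp only [Finset.mem_sdiff, Finset.mem_compl]
  constructor
  · exact fun h => ⟨fun h' => Finset.disjoint_left.1 h2 h' h,
      fun h' => Finset.disjoint_left.1 h3 h' h⟩
  · tauto

/-- A partition is determined by `Y` and `Z₁`, so for fixed `Y` the set `Z₁` ranges over all halves
of the complement. -/
theorem sum_split_eq {V : Type*} [Fintype V] [DecidableEq V] {q : ℕ}
    (hq : Fintype.card V = 4 * q) (f : Finset V → Finset V → ℝ) :
    ∑ s : Split V, f s.Z₁ s.Z₂ =
      ∑ Y ∈ (Finset.univ : Finset V).powersetCard (2 * q), ∑ A ∈ Yᶜ.powersetCard q,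
        f A (Yᶜ \ A) := by
  have hn : Fintype.card V / 2 = 2 * q := by omega
  have hn' : Fintype.card V / 4 = q := by omega
  have hmem : ∀ Y A : Finset V, Y ∈ (Finset.univ : Finset V).powersetCard (2 * q) →
      A ∈ Yᶜ.powersetCard q → Disjoint Y A ∧ Disjoint Y (Yᶜ \ A) ∧ Disjoint A (Yᶜ \ A) ∧
        Y ∪ A ∪ (Yᶜ \ A) = Finset.univ ∧ Y.card = Fintype.card V / 2 ∧
        A.card = Fintype.card V / 4 ∧ (Yᶜ \ A).card = Fintype.card V / 4 := by
    intro Y A hY hA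
    rw [Finset.mem_powersetCard] at hY hA
    refine ⟨disjoint_compl_right.mono_right hA.1, disjoint_compl_right.mono_right
      Finset.sdiff_subset, Finset.disjoint_sdiff, ?_, by omega, by omega, ?_⟩
    · rw [Finset.union_assoc, Finset.union_sdiff_of_subset hA.1, Finset.union_compl]
    · rw [Finset.card_sdiff_of_subset hA.1, Finset.card_compl]; omega
  have hsplit : ∀ s : Split V, s.Y ∈ (Finset.univ : Finset V).powersetCard (2 * q) ∧
      s.Z₁ ∈ s.Yᶜ.powersetCard q := fun s => by
    have h1 : s.Y.card = Fintype.card V / 2 := s.2.2.2.2.2.1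
    have h2 : s.Z₁.card = Fintype.card V / 4 := s.2.2.2.2.2.2.1
    exact ⟨Finset.mem_powersetCard.2 ⟨Finset.subset_univ _, h1.trans hn⟩,
      Finset.mem_powersetCard.2 ⟨s.Z₁_subset, h2.trans hn'⟩⟩
  rw [Finset.sum_sigma']
  refine Finset.sum_bij' (fun s _ => ⟨s.Y, s.Z₁⟩)
    (fun p hp => ⟨(p.1, p.2, p.1ᶜ \ p.2), hmem _ _ (Finset.mem_sigma.1 hp).1
      (Finset.mem_sigma.1 hp).2⟩) ?_ ?_ ?_ ?_ ?_
  · exact fun s _ => Finset.mem_sigma.2 (hsplit s)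
  · exact fun p _ => Finset.mem_univ _
  · exact fun s _ => Subtype.ext (Prod.ext rfl (Prod.ext rfl s.Z₂_eq.symm))
  · exact fun p _ => rfl
  · exact fun s _ => by rw [s.Z₂_eq]

/-- Weight a neighbour by 3/2 in `Z₁` and 1/2 in `Z₂`, and a non-neighbour by 1. For two vertices
placed on opposite sides, the two placements have total weight 3/2 if both are neighbours and 2
otherwise, so the average never exceeds 1. -/
theorem sum_split_nbrCount_le {V : Type*} [Fintype V] [DecidableEq V] (hV : 4 ∣ Fintype.card V)
    (G : SimpleGraph V) (u : V) :
    ∑ s : Split V, (3 / 2 : ℝ) ^ nbrCount G u s.Z₁ * (1 / 2) ^ nbrCount G u s.Z₂ ≤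
      Fintype.card (Split V) := by
  classical
  obtain ⟨q, hq⟩ := hV
  let x : V → ℝ := fun z => if G.Adj u z then 3 / 2 else 1
  let y : V → ℝ := fun z => if G.Adj u z then 1 / 2 else 1
  have h1 : ∀ R : Finset V, (3 / 2 : ℝ) ^ nbrCount G u R = ∏ i ∈ R, x i := fun R => by
    simp only [x, nbrCount, Finset.prod_ite, Finset.prod_const, one_pow, mul_one]
  have h2 : ∀ R : Finset V, (1 / 2 : ℝ) ^ nbrCount G u R = ∏ i ∈ R, y i := fun R => by
    simp only [y, nbrCount, Finset.prod_ite, Finset.prod_const, one_pow, mul_one]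
  have h3 := sum_split_eq hq fun _ _ => 1
  simp only [Finset.sum_const, Finset.card_univ, nsmul_eq_mul, mul_one] at h3
  rw [h3, sum_split_eq hq fun R R' => (3 / 2 : ℝ) ^ nbrCount G u R * (1 / 2) ^ nbrCount G u R']
  simp only [h1, h2]
  refine Finset.sum_le_sum fun Y hY => ?_
  have hc : Yᶜ.card = 2 * q := by
    rw [Finset.card_compl, (Finset.mem_powersetCard.1 hY).2]; omega
  rw [Finset.card_powersetCard, hc]
  refine sum_powersetCard_prod_le q Yᶜ hc x y (fun i => ?_) (fun i => ?_) fun i j _ => ?_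
  · simp only [x]; split_ifs <;> norm_num
  · simp only [y]; split_ifs <;> norm_num
  · simp only [x, y]; split_ifs <;> norm_num

end Balanced

/-! ### Laplace noise: shifts and tails. -/

section LaplaceNoise

theorem measurable_laplace_density (b : ℝ) :
    Measurable fun x : ℝ => ENNReal.ofReal (Real.exp (-|x| / b) / (2 * b)) := by
  fun_prop

theorem lintegral_laplace_add (b g : ℝ) {ψ : ℝ → ENNReal} (hψ : Measurable ψ) :
    ∫⁻ x, ψ (g + x) ∂laplace b =
      ∫⁻ t, ENNReal.ofReal (Real.exp (-|t - g| / b) / (2 * b)) * ψ t := by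
  have hm : Measurable fun x => ψ (g + x) := hψ.comp (measurable_const_add g)
  rw [laplace, lintegral_withDensity_eq_lintegral_mul _ (measurable_laplace_density b) hm]
  rw [← lintegral_add_left_eq_self (fun t => ENNReal.ofReal (Real.exp (-|t - g| / b) / (2 * b)) *
    ψ t) g]
  simp

theorem lintegral_laplace_le_shift {b : ℝ} (hb : 0 < b) (g g' : ℝ) {ψ : ℝ → ENNReal}
    (hψ : Measurable ψ) :
    ∫⁻ x, ψ (g + x) ∂laplace b ≤
      ENNReal.ofReal (Real.exp (|g - g'| / b)) * ∫⁻ x, ψ (g' + x) ∂laplace b := by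
  rw [lintegral_laplace_add b g hψ, lintegral_laplace_add b g' hψ,
    ← lintegral_const_mul _ (by fun_prop)]
  refine lintegral_mono fun t => ?_
  rw [← mul_assoc, ← ENNReal.ofReal_mul (Real.exp_nonneg _)]
  gcongr
  rw [← mul_div_assoc, ← Real.exp_add]
  gcongr
  rw [← add_div]
  gcongr
  have := abs_sub_le t g g'
  linarith

/-- Replacing -|x| by x in the exponent gives a bound valid for c of either sign. -/
theorem laplace_Iio_le {b : ℝ} (hb : 0 < b) (c : ℝ) :
    laplace b (Set.Iio c) ≤ ENNReal.ofReal (Real.exp (c / b) / 2) := by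
  have hint : IntegrableOn (fun x => Real.exp (b⁻¹ * x)) (Set.Iic c) :=
    integrableOn_exp_mul_Iic (inv_pos.2 hb) c
  rw [laplace, withDensity_apply _ measurableSet_Iio]
  calc ∫⁻ x in Set.Iio c, ENNReal.ofReal (Real.exp (-|x| / b) / (2 * b))
      ≤ ∫⁻ x in Set.Iic c, ENNReal.ofReal (Real.exp (b⁻¹ * x) / (2 * b)) := by
        refine (lintegral_mono_set Set.Iio_subset_Iic_self).trans (lintegral_mono fun x => ?_)
        gcongr
        rw [inv_mul_eq_div]
        gcongr
        exact neg_abs_le x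
    _ = ENNReal.ofReal (∫ x in Set.Iic c, Real.exp (b⁻¹ * x) / (2 * b)) :=
        (ofReal_integral_eq_lintegral_ofReal (hint.div_const _)
          (Filter.Eventually.of_forall fun x => by positivity)).symm
    _ = _ := by
        rw [integral_div, integral_exp_mul_Iic (inv_pos.2 hb)]
        congr 1
        rw [inv_mul_eq_div]
        field_simp

theorem laplace_Ioi_le {b : ℝ} (hb : 0 < b) (c : ℝ) :
    laplace b (Set.Ioi c) ≤ ENNReal.ofReal (Real.exp (-c / b) / 2) := by
  have hneg : (laplace b).map (fun x => -x) = laplace b := by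
    have h := (Measure.measurePreserving_neg (volume : Measure ℝ))
    ext s hs
    rw [Measure.map_apply measurable_neg hs, laplace, withDensity_apply _ hs,
      withDensity_apply _ (measurable_neg hs)]
    rw [← h.setLIntegral_comp_preimage hs (measurable_laplace_density b)]
    simp
  rw [← hneg, Measure.map_apply measurable_neg measurableSet_Ioi]
  have : (fun x : ℝ => -x) ⁻¹' Set.Ioi c = Set.Iio (-c) := by ext; simp
  rw [this]
  exact laplace_Iio_le hb (-c)

end LaplaceNoise

/-! ### Gaussian matrices: change of measure and the Gaussian mechanism. -/

section GaussianNoise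

theorem lintegral_pi_prod {ι : Type*} [Fintype ι] {X : ι → Type*} [∀ i, MeasurableSpace (X i)]
    (μ : ∀ i, Measure (X i)) [∀ i, IsProbabilityMeasure (μ i)] {f : ∀ i, X i → ENNReal}
    (hf : ∀ i, Measurable (f i)) :
    ∫⁻ x, ∏ i, f i (x i) ∂Measure.pi μ = ∏ i, ∫⁻ x, f i x ∂μ i := by
  rw [lintegral_prod_eq_prod_lintegral_of_indepFun Finset.univ (fun i (x : ∀ i, X i) => f i (x i))
    (iIndepFun_pi fun i => (hf i).aemeasurable) fun i => (hf i).comp (measurable_pi_apply i)]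
  exact Finset.prod_congr rfl fun i _ => (measurePreserving_eval μ i).lintegral_comp (hf i)

theorem pi_withDensity {ι : Type*} [Fintype ι] {X : ι → Type*} [∀ i, MeasurableSpace (X i)]
    (μ : ∀ i, Measure (X i)) [∀ i, IsProbabilityMeasure (μ i)] {f : ∀ i, X i → ENNReal}
    (hf : ∀ i, Measurable (f i)) [∀ i, SigmaFinite ((μ i).withDensity (f i))] :
    (Measure.pi fun i => (μ i).withDensity (f i)) =
      (Measure.pi μ).withDensity fun x => ∏ i, f i (x i) := by
  refine Measure.pi_eq fun s hs => ?_
  rw [withDensity_apply _ (MeasurableSet.univ_pi hs),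
    ← lintegral_indicator (MeasurableSet.univ_pi hs)]
  have h : ∀ x : ∀ i, X i, (Set.univ.pi s).indicator (fun x => ∏ i, f i (x i)) x =
      ∏ i, (s i).indicator (f i) (x i) := fun x => by
    by_cases hx : x ∈ Set.univ.pi s
    · rw [Set.indicator_of_mem hx]
      exact Finset.prod_congr rfl fun i _ => (Set.indicator_of_mem (hx i trivial) _).symm
    · rw [Set.indicator_of_notMem hx]
      obtain ⟨i, hi⟩ : ∃ i, x i ∉ s i := by simpa [Set.mem_pi] using hx
      exact (Finset.prod_eq_zero (Finset.mem_univ i) (Set.indicator_of_notMem hi _)).symm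
  simp only [h]
  rw [lintegral_pi_prod μ fun i => (hf i).indicator (hs i)]
  exact Finset.prod_congr rfl fun i _ => by
    rw [lintegral_indicator (hs i), withDensity_apply _ (hs i)]

theorem gaussianReal_map_add_eq_withDensity (h : ℝ) :
    (gaussianReal 0 1).map (fun x => x + h) =
      (gaussianReal 0 1).withDensity fun x => ENNReal.ofReal (Real.exp (h * x - h ^ 2 / 2)) := by
  rw [gaussianReal_map_add_const, gaussianReal_of_var_ne_zero _ one_ne_zero,
    gaussianReal_of_var_ne_zero _ one_ne_zero,
    ← withDensity_mul _ (measurable_gaussianPDF _ _) (by fun_prop)]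
  congr 1
  ext x
  rw [Pi.mul_apply, gaussianPDF, gaussianPDF, ← ENNReal.ofReal_mul (gaussianPDFReal_nonneg _ _ _)]
  congr 1
  rw [gaussianPDFReal, gaussianPDFReal, mul_assoc (√_)⁻¹ (Real.exp _), ← Real.exp_add]
  congr 2
  push_cast
  ring

theorem lintegral_exp_mul_gaussianReal (v : NNReal) (a : ℝ) :
    ∫⁻ x, ENNReal.ofReal (Real.exp (a * x)) ∂gaussianReal 0 v =
      ENNReal.ofReal (Real.exp (v * a ^ 2 / 2)) := by
  rw [← ofReal_integral_eq_lintegral_ofReal (integrable_exp_mul_gaussianReal a)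
    (Filter.Eventually.of_forall fun x => Real.exp_nonneg _)]
  have h := congrFun (mgf_id_gaussianReal (μ := 0) (v := v)) a
  simp only [mgf, id, zero_mul, zero_add] at h
  rw [h]

/-- The weighted density is √2 times the density of variance 2. -/
theorem lintegral_exp_sq_gaussianReal :
    ∫⁻ x, ENNReal.ofReal (Real.exp (x ^ 2 / 4)) ∂gaussianReal 0 1 = ENNReal.ofReal (√2) := by
  rw [gaussianReal_of_var_ne_zero _ one_ne_zero,
    lintegral_withDensity_eq_lintegral_mul _ (measurable_gaussianPDF _ _) (by fun_prop)]
  have h : ∀ x : ℝ, (gaussianPDF 0 1 * fun x => ENNReal.ofReal (Real.exp (x ^ 2 / 4))) x =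
      ENNReal.ofReal (√2) * gaussianPDF 0 2 x := fun x => by
    rw [Pi.mul_apply, gaussianPDF, gaussianPDF, ← ENNReal.ofReal_mul (gaussianPDFReal_nonneg _ _ _),
      ← ENNReal.ofReal_mul (Real.sqrt_nonneg _)]
    congr 1
    have h2 : √(2 * Real.pi * 2) = √2 * √(2 * Real.pi) := by
      rw [← Real.sqrt_mul zero_le_two, mul_comm]
    rw [gaussianPDFReal, gaussianPDFReal, mul_assoc (√_)⁻¹ (Real.exp _), ← Real.exp_add,
      ← mul_assoc]
    congr 1
    · push_cast
      rw [h2, mul_one]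
      field_simp
    · congr 1; push_cast; ring
  simp only [h]
  rw [lintegral_const_mul _ (measurable_gaussianPDF _ _), lintegral_gaussianPDF_eq_one _ two_ne_zero,
    mul_one]

variable {a b : Type*} [Fintype a] [Fintype b]

theorem lintegral_gaussianMatrix_exp_sum (h : a → b → ℝ) :
    ∫⁻ x, ENNReal.ofReal (Real.exp (∑ i, ∑ j, h i j * x i j)) ∂gaussianMatrix a b 1 =
      ENNReal.ofReal (Real.exp (∑ i, ∑ j, h i j ^ 2 / 2)) := by
  simp only [Real.exp_sum, gaussianMatrix,
    ENNReal.ofReal_prod_of_nonneg fun _ _ => Finset.prod_nonneg fun _ _ => Real.exp_nonneg _,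
    ENNReal.ofReal_prod_of_nonneg fun _ _ => Real.exp_nonneg _]
  rw [lintegral_pi_prod (X := fun _ => b → ℝ) _ (f := fun i x => ∏ j, ENNReal.ofReal (Real.exp (h i j * x j)))
    fun i => by fun_prop]
  refine Finset.prod_congr rfl fun i _ => ?_
  rw [lintegral_pi_prod _ (f := fun j x => ENNReal.ofReal (Real.exp (h i j * x)))
    fun i => by fun_prop]
  refine Finset.prod_congr rfl fun j _ => ?_
  rw [lintegral_exp_mul_gaussianReal]
  simp

theorem gaussianMatrix_map_add_eq_withDensity (h : a → b → ℝ) :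
    (gaussianMatrix a b 1).map (fun x => x + h) = (gaussianMatrix a b 1).withDensity fun x =>
      ENNReal.ofReal (Real.exp (∑ i, ∑ j, (h i j * x i j - h i j ^ 2 / 2))) := by
  have h1 : ∀ t : ℝ, IsProbabilityMeasure ((gaussianReal 0 1).withDensity fun x =>
      ENNReal.ofReal (Real.exp (t * x - t ^ 2 / 2))) := fun t => by
    rw [← gaussianReal_map_add_eq_withDensity]
    exact Measure.isProbabilityMeasure_map (by fun_prop)
  have hrow : ∀ r : b → ℝ, (Measure.pi fun _ : b => gaussianReal 0 1).map (fun x => x + r) =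
      (Measure.pi fun _ : b => gaussianReal 0 1).withDensity fun x =>
        ∏ j, ENNReal.ofReal (Real.exp (r j * x j - r j ^ 2 / 2)) := fun r => by
    rw [← pi_withDensity (fun _ => gaussianReal 0 1)
      (f := fun j x => ENNReal.ofReal (Real.exp (r j * x - r j ^ 2 / 2))) fun i => by fun_prop]
    simp only [← gaussianReal_map_add_eq_withDensity]
    have : ∀ j, SigmaFinite ((gaussianReal 0 1).map fun x => x + r j) := fun j => by
      rw [gaussianReal_map_add_eq_withDensity]; infer_instance
    exact Measure.pi_map_pi (f := fun j x => x + r j) fun j => by fun_prop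
  have h2 : ∀ r : b → ℝ, IsProbabilityMeasure
      ((Measure.pi fun _ : b => gaussianReal 0 1).withDensity fun x =>
        ∏ j, ENNReal.ofReal (Real.exp (r j * x j - r j ^ 2 / 2))) := fun r => by
    rw [← hrow]
    exact Measure.isProbabilityMeasure_map (by fun_prop)
  have hs : ((1 : ℝ) ^ 2).toNNReal = 1 := by simp
  simp only [Real.exp_sum, gaussianMatrix, hs,
    ENNReal.ofReal_prod_of_nonneg fun _ _ => Finset.prod_nonneg fun _ _ => Real.exp_nonneg _,
    ENNReal.ofReal_prod_of_nonneg fun _ _ => Real.exp_nonneg _]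
  rw [← pi_withDensity (fun _ : a => Measure.pi fun _ : b => gaussianReal 0 1)
      (f := fun i x => ∏ j, ENNReal.ofReal (Real.exp (h i j * x j - h i j ^ 2 / 2)))
      fun i => by fun_prop]
  simp only [← hrow]
  have : ∀ i, SigmaFinite ((Measure.pi fun _ : b => gaussianReal 0 1).map fun x => x + h i) :=
    fun i => by rw [hrow]; infer_instance
  exact Measure.pi_map_pi (f := fun i x => x + h i) fun j => by fun_prop

/-- The Gaussian mechanism. -/
theorem gaussianMatrix_le_shift (h : a → b → ℝ) {ε c : ℝ} (hε : 0 < ε) (hc : 0 < c)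
    (hcε : ε ≤ 2 * c ^ 2) (hh : ∑ i, ∑ j, h i j ^ 2 ≤ (ε / c) ^ 2) {S : Set (a → b → ℝ)}
    (hS : MeasurableSet S) :
    gaussianMatrix a b 1 S ≤ ENNReal.ofReal (Real.exp ε) *
      gaussianMatrix a b 1 ((fun x => x + h) ⁻¹' S) +
        ENNReal.ofReal (Real.exp (-c ^ 2 / 2 + ε / 2)) := by
  set γ := gaussianMatrix a b 1 with hγ
  set r := ∑ i, ∑ j, h i j ^ 2 with hr
  -- D is the log-likelihood ratio of the shifted law to the original one; the privacy loss exceeds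
  -- ε exactly where D < -ε.
  set D : (a → b → ℝ) → ℝ := fun x => ∑ i, ∑ j, (h i j * x i j - h i j ^ 2 / 2) with hD
  have hDm : Measurable D := by fun_prop
  have hB : MeasurableSet {x | D x < -ε} := measurableSet_lt hDm measurable_const
  -- The optimal Chernoff exponent: it minimizes -lε + (l + l²) r / 2 at the extreme value r = (ε /
  -- c)².
  set l := c ^ 2 / ε - 1 / 2 with hl
  have hl0 : 0 ≤ l := by
    rw [hl, sub_nonneg, div_le_div_iff₀ two_pos hε]; linarith
  have h1 : γ (S \ {x | D x < -ε}) ≤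
      ENNReal.ofReal (Real.exp ε) * γ ((fun x => x + h) ⁻¹' S) := by
    rw [← Measure.map_apply (by fun_prop) hS, gaussianMatrix_map_add_eq_withDensity,
      withDensity_apply _ hS, ← lintegral_const_mul _ (by fun_prop)]
    calc γ (S \ {x | D x < -ε}) = ∫⁻ x in S \ {x | D x < -ε}, 1 ∂γ := by simp
      _ ≤ ∫⁻ x in S \ {x | D x < -ε}, ENNReal.ofReal (Real.exp ε) *
            ENNReal.ofReal (Real.exp (D x)) ∂γ := by
          refine setLIntegral_mono' (hS.diff hB) fun x hx => ?_
          rw [← ENNReal.ofReal_mul (Real.exp_nonneg _), ← Real.exp_add, ENNReal.one_le_ofReal,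
            Real.one_le_exp_iff]
          have : ¬ D x < -ε := hx.2
          linarith
      _ ≤ _ := lintegral_mono_set Set.sdiff_subset
  have h2 : γ {x | D x < -ε} ≤ ENNReal.ofReal (Real.exp (-c ^ 2 / 2 + ε / 2)) := by
    calc γ {x | D x < -ε} = ∫⁻ x in {x | D x < -ε}, 1 ∂γ := by simp
      _ ≤ ∫⁻ x in {x | D x < -ε}, ENNReal.ofReal (Real.exp (-l * ε + l * r / 2)) *
            ENNReal.ofReal (Real.exp (∑ i, ∑ j, (-l * h i j) * x i j)) ∂γ := by
          refine setLIntegral_mono' hB fun x hx => ?_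
          rw [← ENNReal.ofReal_mul (Real.exp_nonneg _), ← Real.exp_add, ENNReal.one_le_ofReal,
            Real.one_le_exp_iff]
          have e1 : D x = ∑ i, ∑ j, h i j * x i j - r / 2 := by
            simp only [hD, hr, Finset.sum_sub_distrib, Finset.sum_div]
          have e2 : ∑ i, ∑ j, (-l * h i j) * x i j = -l * ∑ i, ∑ j, h i j * x i j := by
            simp only [Finset.mul_sum, mul_assoc]
          have e3 : D x < -ε := hx
          rw [e2]
          nlinarith
      _ ≤ ∫⁻ x, ENNReal.ofReal (Real.exp (-l * ε + l * r / 2)) *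
            ENNReal.ofReal (Real.exp (∑ i, ∑ j, (-l * h i j) * x i j)) ∂γ :=
          setLIntegral_le_lintegral _ _
      _ = ENNReal.ofReal (Real.exp (-l * ε + l * r / 2 + l ^ 2 * r / 2)) := by
          rw [lintegral_const_mul _ (by fun_prop), lintegral_gaussianMatrix_exp_sum,
            ← ENNReal.ofReal_mul (Real.exp_nonneg _), ← Real.exp_add]
          congr 3
          simp only [hr, Finset.mul_sum, Finset.sum_div]
          exact Finset.sum_congr rfl fun _ _ => Finset.sum_congr rfl fun _ _ => by ring
      _ ≤ _ := by
          refine ENNReal.ofReal_le_ofReal (Real.exp_le_exp.2 ?_)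
          have e1 : (l + l ^ 2) * r ≤ (l + l ^ 2) * (ε / c) ^ 2 :=
            mul_le_mul_of_nonneg_left hh (by positivity)
          have e2 : (l + l ^ 2) * (ε / c) ^ 2 = c ^ 2 - ε ^ 2 / (4 * c ^ 2) := by
            rw [hl]; field_simp; ring
          have e3 : l * ε = c ^ 2 - ε / 2 := by rw [hl]; field_simp
          have e4 : 0 ≤ ε ^ 2 / (4 * c ^ 2) := by positivity
          linarith
  calc γ S ≤ γ (S \ {x | D x < -ε} ∪ {x | D x < -ε}) := measure_mono (by
        intro x hx; by_cases h : x ∈ {x | D x < -ε}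
        · exact Or.inr h
        · exact Or.inl ⟨hx, h⟩)
    _ ≤ _ := measure_union_le _ _
    _ ≤ _ := add_le_add h1 h2

end GaussianNoise

/-! ### The random projection rarely enlarges the Frobenius norm by more than √2. -/

section RandomProjection

variable {a b c : Type*} [Fintype a] [Fintype b] [Fintype c]

theorem lintegral_pi_gaussianReal_exp_sum (v : NNReal) (h : b → ℝ) :
    ∫⁻ x, ENNReal.ofReal (Real.exp (∑ j, h j * x j)) ∂(Measure.pi fun _ : b => gaussianReal 0 v) =
      ENNReal.ofReal (Real.exp (∑ j, v * h j ^ 2 / 2)) := by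
  simp only [Real.exp_sum, ENNReal.ofReal_prod_of_nonneg fun _ _ => Real.exp_nonneg _]
  rw [lintegral_pi_prod _ (f := fun j x => ENNReal.ofReal (Real.exp (h j * x)))
    fun i => by fun_prop]
  exact Finset.prod_congr rfl fun j _ => lintegral_exp_mul_gaussianReal v (h j)

/-- An auxiliary standard Gaussian g linearizes the square: exp(t s²) = E exp(√(2t) s g). After
exchanging the integrals, the normalization of t leaves E exp(g² / 4). -/
theorem lintegral_pi_gaussianReal_exp_sq (v : NNReal) (x : b → ℝ) {t : ℝ} (ht : 0 ≤ t)
    (h : t * (v * ∑ y, x y ^ 2) = 1 / 4) :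
    ∫⁻ p, ENNReal.ofReal (Real.exp (t * (∑ y, p y * x y) ^ 2))
      ∂(Measure.pi fun _ : b => gaussianReal 0 v) = ENNReal.ofReal (√2) := by
  have h2 : √(2 * t) ^ 2 = 2 * t := Real.sq_sqrt (by positivity)
  have h1 : ∀ p : b → ℝ, ENNReal.ofReal (Real.exp (t * (∑ y, p y * x y) ^ 2)) =
      ∫⁻ g, ENNReal.ofReal (Real.exp (√(2 * t) * (∑ y, p y * x y) * g)) ∂gaussianReal 0 1 :=
    fun p => by
      rw [lintegral_exp_mul_gaussianReal]
      congr 2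
      rw [mul_pow, h2, NNReal.coe_one]
      ring
  simp only [h1]
  rw [lintegral_lintegral_swap (by
    refine Measurable.aemeasurable ?_
    simp only [Function.uncurry_def]
    fun_prop), ← lintegral_exp_sq_gaussianReal]
  refine lintegral_congr fun g => ?_
  have h3 : ∀ p : b → ℝ, √(2 * t) * (∑ y, p y * x y) * g = ∑ y, (√(2 * t) * g * x y) * p y :=
    fun p => by
      rw [Finset.mul_sum, Finset.sum_mul]
      exact Finset.sum_congr rfl fun _ _ => by ring
  simp only [h3]
  rw [lintegral_pi_gaussianReal_exp_sum]
  congr 2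
  have h4 : ∑ y, (v : ℝ) * (√(2 * t) * g * x y) ^ 2 / 2 = t * (v * ∑ y, x y ^ 2) * g ^ 2 := by
    simp only [Finset.mul_sum, Finset.sum_mul]
    refine Finset.sum_congr rfl fun y _ => ?_
    rw [mul_pow, mul_pow, h2]
    ring
  rw [h4, h]
  ring

/-- The coordinates of pX are dependent, but Jensen's inequality with weights ‖column z‖² / ‖X‖_F²
reduces the claim to one column at a time, each contributing √2. -/
theorem lintegral_pi_gaussianReal_exp_sum_sq_le {v : NNReal} (hv : v ≠ 0) (X : b → c → ℝ)
    (hX : 0 < ∑ y, ∑ z, X y z ^ 2) :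
    ∫⁻ p, ENNReal.ofReal (Real.exp ((4 * (v * ∑ y, ∑ z, X y z ^ 2))⁻¹ *
      ∑ z, (∑ y, p y * X y z) ^ 2)) ∂(Measure.pi fun _ : b => gaussianReal 0 v) ≤
      ENNReal.ofReal (√2) := by
  set F := ∑ y, ∑ z, X y z ^ 2 with hF
  have hv0 : 0 < (v : ℝ) := lt_of_le_of_ne v.2 fun h => hv (NNReal.coe_eq_zero.1 h.symm)
  set t := (4 * (v * F))⁻¹ with ht
  have ht0 : 0 < t := by positivity
  set N : c → ℝ := fun z => ∑ y, X y z ^ 2 with hN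
  have hN0 : ∀ z, 0 ≤ N z := fun z => Finset.sum_nonneg fun _ _ => sq_nonneg _
  have hsumN : ∑ z, N z = F := Finset.sum_comm
  have hw1 : ∑ z, N z / F = 1 := by rw [← Finset.sum_div, hsumN, div_self hX.ne']
  have hzero : ∀ z, N z = 0 → ∀ y, X y z = 0 := fun z hz y => by
    have := (Finset.sum_eq_zero_iff_of_nonneg fun y _ => sq_nonneg (X y z)).1 hz y
      (Finset.mem_univ y)
    exact pow_eq_zero_iff two_ne_zero |>.1 this
  have hj : ∀ p : b → ℝ, Real.exp (t * ∑ z, (∑ y, p y * X y z) ^ 2) ≤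
      ∑ z, N z / F * Real.exp (t * F / N z * (∑ y, p y * X y z) ^ 2) := fun p => by
    have h := convexOn_exp.map_sum_le (t := Finset.univ) (w := fun z => N z / F)
      (p := fun z => t * F / N z * (∑ y, p y * X y z) ^ 2)
      (fun z _ => div_nonneg (hN0 z) hX.le) hw1 fun _ _ => Set.mem_univ _
    simp only [smul_eq_mul] at h
    refine le_trans (le_of_eq ?_) h
    rw [Finset.mul_sum]
    congr 1
    refine Finset.sum_congr rfl fun z _ => ?_
    rcases (hN0 z).eq_or_lt with hz | hz
    · simp [hzero z hz.symm]
    · field_simp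
  calc _ ≤ ∫⁻ p, ∑ z, ENNReal.ofReal (N z / F) *
          ENNReal.ofReal (Real.exp (t * F / N z * (∑ y, p y * X y z) ^ 2))
          ∂(Measure.pi fun _ : b => gaussianReal 0 v) := by
        refine lintegral_mono fun p => ?_
        refine (ENNReal.ofReal_le_ofReal (hj p)).trans (le_of_eq ?_)
        rw [ENNReal.ofReal_sum_of_nonneg fun z _ => mul_nonneg (div_nonneg (hN0 z) hX.le)
          (Real.exp_nonneg _)]
        exact Finset.sum_congr rfl fun z _ => ENNReal.ofReal_mul (div_nonneg (hN0 z) hX.le)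
    _ = ∑ z, ENNReal.ofReal (N z / F) * ∫⁻ p,
          ENNReal.ofReal (Real.exp (t * F / N z * (∑ y, p y * X y z) ^ 2))
          ∂(Measure.pi fun _ : b => gaussianReal 0 v) := by
        rw [lintegral_finsetSum _ fun z _ => by fun_prop]
        exact Finset.sum_congr rfl fun z _ => lintegral_const_mul _ (by fun_prop)
    _ = ∑ z, ENNReal.ofReal (N z / F) * ENNReal.ofReal (√2) := by
        refine Finset.sum_congr rfl fun z _ => ?_
        rcases (hN0 z).eq_or_lt with hz | hz
        · simp [← hz]
        · rw [lintegral_pi_gaussianReal_exp_sq v (fun y => X y z)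
            (div_nonneg (mul_pos ht0 hX).le hz.le)]
          change t * F / N z * (v * N z) = 1 / 4
          rw [ht]; field_simp
    _ = ENNReal.ofReal (√2) := by
        rw [← Finset.sum_mul, ← ENNReal.ofReal_sum_of_nonneg fun z _ => div_nonneg (hN0 z) hX.le,
          hw1, ENNReal.ofReal_one, one_mul]

/-- Chernoff's bound over the independent rows of P, with t chosen so that the threshold 2‖X‖²
contributes exp(-m/2) and each row at most √2. -/
theorem gaussianMatrix_norm_mul_tail [Nonempty a] (X : Matrix b c ℝ) :
    gaussianMatrix a b (1 / √(Fintype.card a : ℝ))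
      {P | 2 * ∑ y, ∑ z, X y z ^ 2 < ∑ i, ∑ z, (Matrix.of P * X) i z ^ 2} ≤
      ENNReal.ofReal (Real.exp (-(Fintype.card a : ℝ) / 2) * √2 ^ Fintype.card a) := by
  set m := Fintype.card a with hm
  have hm0 : (0 : ℝ) < m := by exact_mod_cast Fintype.card_pos
  set F := ∑ y, ∑ z, X y z ^ 2 with hF
  have hF0 : 0 ≤ F := Finset.sum_nonneg fun _ _ => Finset.sum_nonneg fun _ _ => sq_nonneg _
  rcases hF0.eq_or_lt with h0 | h0
  · have hX : ∀ y z, X y z = 0 := fun y z => by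
      have h1 := (Finset.sum_eq_zero_iff_of_nonneg fun y _ =>
        Finset.sum_nonneg fun z _ => sq_nonneg (X y z)).1 h0.symm y (Finset.mem_univ y)
      have h2 := (Finset.sum_eq_zero_iff_of_nonneg fun z _ => sq_nonneg (X y z)).1 h1 z
        (Finset.mem_univ z)
      exact pow_eq_zero_iff two_ne_zero |>.1 h2
    simp [← h0, Matrix.mul_apply, hX]
  set v : NNReal := ((1 / √(m : ℝ)) ^ 2).toNNReal with hv
  have hv1 : (v : ℝ) = 1 / m := by
    rw [hv, Real.coe_toNNReal _ (sq_nonneg _), div_pow, one_pow, Real.sq_sqrt hm0.le]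
  have hv0 : v ≠ 0 := fun h => by
    rw [h, NNReal.coe_zero] at hv1
    exact (one_div_pos.2 hm0).ne hv1
  set t := (4 * (v * F))⁻¹ with ht
  have htF : t * (2 * F) = m / 2 := by rw [ht, hv1]; field_simp; ring
  have ht0 : 0 < t := by rw [ht, hv1]; positivity
  let R : (b → ℝ) → ℝ := fun p => ∑ z, (∑ y, p y * X y z) ^ 2
  have hR : ∀ P : a → b → ℝ, ∑ i, ∑ z, (Matrix.of P * X) i z ^ 2 = ∑ i, R (P i) := fun P => by
    simp [R, Matrix.mul_apply]
  have hRm : Measurable R := by fun_prop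
  simp only [hR]
  have hS : MeasurableSet {P : a → b → ℝ | 2 * F < ∑ i, R (P i)} :=
    measurableSet_lt measurable_const (by fun_prop)
  set μ := gaussianMatrix a b (1 / √(m : ℝ)) with hμ
  calc μ {P : a → b → ℝ | 2 * F < ∑ i, R (P i)}
      = ∫⁻ P in {P : a → b → ℝ | 2 * F < ∑ i, R (P i)}, 1 ∂μ := by simp
    _ ≤ ∫⁻ P in {P : a → b → ℝ | 2 * F < ∑ i, R (P i)}, ENNReal.ofReal (Real.exp (-(m : ℝ) / 2)) *
          ∏ i, ENNReal.ofReal (Real.exp (t * R (P i))) ∂μ := by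
        refine setLIntegral_mono' hS fun P hP => ?_
        rw [← ENNReal.ofReal_prod_of_nonneg fun _ _ => Real.exp_nonneg _, ← Real.exp_sum,
          ← ENNReal.ofReal_mul (Real.exp_nonneg _), ← Real.exp_add, ENNReal.one_le_ofReal,
          Real.one_le_exp_iff, ← Finset.mul_sum]
        have h1 : 2 * F < ∑ i, R (P i) := hP
        have h2 := mul_lt_mul_of_pos_left h1 ht0
        linarith
    _ ≤ ∫⁻ P, ENNReal.ofReal (Real.exp (-(m : ℝ) / 2)) *
          ∏ i, ENNReal.ofReal (Real.exp (t * R (P i))) ∂μ := setLIntegral_le_lintegral _ _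
    _ ≤ _ := by
        rw [lintegral_const_mul _ (by fun_prop), ENNReal.ofReal_mul (Real.exp_nonneg _), hμ,
          gaussianMatrix, lintegral_pi_prod (X := fun _ => b → ℝ) _
          (f := fun i p => ENNReal.ofReal (Real.exp (t * R p))) fun i => by fun_prop,
          Finset.prod_const, Finset.card_univ, ENNReal.ofReal_pow (Real.sqrt_nonneg _)]
        gcongr
        exact lintegral_pi_gaussianReal_exp_sum_sq_le hv0 X h0

/-- The tail decays at rate (1 - ln 2)/2 per row, and 64 (1 - ln 2)/2 > 1. The hypothesis n ≥ 4
gives 2n/δ ≥ 8/δ. -/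
theorem exp_neg_mul_sqrt_two_pow_le {V : Type*} [Fintype V] (hV : 4 ≤ Fintype.card V) {δ : ℝ}
    (hδ : 0 < δ) (hδ1 : δ < 1) :
    Real.exp (-(projDim V δ : ℝ) / 2) * √2 ^ projDim V δ ≤ δ / 8 := by
  have hn : (4 : ℝ) ≤ Fintype.card V := by exact_mod_cast hV
  have h1 : √2 = Real.exp (Real.log 2 / 2) := by
    rw [Real.exp_half, Real.exp_log two_pos]
  have h2 : 64 * Real.log (2 * (Fintype.card V : ℝ) / δ) ≤ projDim V δ := Nat.le_ceil _
  have h3 : Real.log (8 / δ) ≤ Real.log (2 * (Fintype.card V : ℝ) / δ) :=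
    Real.log_le_log (by positivity) (by gcongr; linarith)
  have h4 : 0 < Real.log (8 / δ) := Real.log_pos (by rw [lt_div_iff₀ hδ]; linarith)
  have h5 : δ / 8 = Real.exp (-Real.log (8 / δ)) := by
    rw [Real.exp_neg, Real.exp_log (by positivity), inv_div]
  rw [h1, ← Real.exp_nat_mul, ← Real.exp_add, h5, Real.exp_le_exp]
  have := Real.log_two_lt_d9
  nlinarith

end RandomProjection

/-! ### Conditional privacy for a fixed partition and fixed noisy scalars. -/

section FixedSplit

variable {V : Type*} [Fintype V] [DecidableEq V]

open Classical in
/-- The released result as a function of the released values `t` of `d̃_k` and `w` of `σ̃₁` and of the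
Gaussian matrices. -/
noncomputable def result (ε δ : ℝ) (k : ℕ) (G : SimpleGraph V) (s : Split V) (t w : ℝ)
    (P : Fin (projDim V δ) → s.Y → ℝ) (N : Fin (projDim V δ) → s.Z₂ → ℝ) :
    Unit ⊕ (Fin (projDim V δ) → s.Z₂ → ℝ) :=
  if t ≤ 10 * (8 / ε * Real.log (4 / δ)) then Sum.inl ()
  else Sum.inr (noisyPoints ε δ k G s t w P N)

theorem measurable_result (ε δ : ℝ) (k : ℕ) (G : SimpleGraph V) (s : Split V) :
    Measurable fun ω : Noise δ s => result ε δ k G s ω.1 ω.2.1 ω.2.2.1 ω.2.2.2 := by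
  classical
  refine Measurable.ite (measurableSet_le measurable_fst measurable_const) measurable_const ?_
  refine measurable_inr.comp (measurable_pi_lambda _ fun i => measurable_pi_lambda _ fun z => ?_)
  have hP : ∀ y, Measurable fun ω : Noise δ s => ω.2.2.1 i y := fun y => by fun_prop
  have hN : Measurable fun ω : Noise δ s => ω.2.2.2 i z := by fun_prop
  simp only [noisyPoints, Matrix.mul_apply (M := Matrix.of _), Matrix.of_apply]
  exact (Finset.measurable_sum _ fun y _ => (hP y).mul_const _).add
    ((((((measurable_fst.comp measurable_snd).div measurable_fst).const_mul _).div_const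
      _).mul_const _).mul hN)

/-- The conditional probability of `S` given the partition, `d̃_k`, `σ̃₁` and `P`. -/
noncomputable def condProb (ε δ : ℝ) (k : ℕ) (G : SimpleGraph V) (s : Split V)
    (S : Set (View V δ)) (t w : ℝ) (P : Fin (projDim V δ) → s.Y → ℝ) : ENNReal :=
  gaussianMatrix (Fin (projDim V δ)) s.Z₂ 1 {N | ⟨s, t, w, result ε δ k G s t w P N⟩ ∈ S}

theorem measurable_view (ε δ : ℝ) (k : ℕ) (G : SimpleGraph V) (s : Split V) :
    Measurable fun ω : Noise δ s =>
      (⟨s, ω.1, ω.2.1, result ε δ k G s ω.1 ω.2.1 ω.2.2.1 ω.2.2.2⟩ : View V δ) :=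
  (measurable_mk s).comp (measurable_fst.prodMk
    ((measurable_fst.comp measurable_snd).prodMk (measurable_result ε δ k G s)))

theorem measurable_condProb (ε δ : ℝ) (k : ℕ) (G : SimpleGraph V) (s : Split V)
    {S : Set (View V δ)} (hS : MeasurableSet S) :
    Measurable fun p : ℝ × ℝ × (Fin (projDim V δ) → s.Y → ℝ) =>
      condProb ε δ k G s S p.1 p.2.1 p.2.2 := by
  have h : MeasurableSet {p : (ℝ × ℝ × (Fin (projDim V δ) → s.Y → ℝ)) ×
      (Fin (projDim V δ) → s.Z₂ → ℝ) | (⟨s, p.1.1, p.1.2.1,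
        result ε δ k G s p.1.1 p.1.2.1 p.1.2.2 p.2⟩ : View V δ) ∈ S} := by
    have hr : Measurable fun p : (ℝ × ℝ × (Fin (projDim V δ) → s.Y → ℝ)) ×
        (Fin (projDim V δ) → s.Z₂ → ℝ) => ((p.1.1, p.1.2.1, p.1.2.2, p.2) : Noise δ s) := by
      fun_prop
    exact ((measurable_view ε δ k G s).comp hr) hS
  exact measurable_measure_prodMk_left (ν := gaussianMatrix (Fin (projDim V δ)) s.Z₂ 1) h

/-- `σ_k(Â₁) - σ_{k+1}(Â₁)`. -/
noncomputable def gap (k : ℕ) (G : SimpleGraph V) (s : Split V) : ℝ :=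
  sigma (subAdj G s.Y s.Z₁) k - sigma (subAdj G s.Y s.Z₁) (k + 1)

/-- `Π_{Â₁}^{(k)} Â₂`. -/
noncomputable def projected (k : ℕ) (G : SimpleGraph V) (s : Split V) : Matrix s.Y s.Z₂ ℝ :=
  topProj k (subAdj G s.Y s.Z₁) * subAdj G s.Y s.Z₂

theorem map_run_apply {ε : ℝ} (hε : 0 < ε) (δ : ℝ) (k : ℕ) (G : SimpleGraph V) (s : Split V)
    {S : Set (View V δ)} (hS : MeasurableSet S) :
    (noiseLaw ε δ s).map (run ε δ k G s) S =
      ∫⁻ x, ∫⁻ y, ∫⁻ P, condProb ε δ k G s S (gap k G s - 8 / ε * Real.log (4 / δ) + x)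
        (sigma (subAdj G s.Y s.Z₂) 1 + 4 / ε * Real.log (4 / δ) + y) P
        ∂gaussianMatrix (Fin (projDim V δ)) s.Y (1 / √(projDim V δ : ℝ))
        ∂laplace (4 / ε) ∂laplace (8 / ε) := by
  have h1 := isProbabilityMeasure_laplace (b := 8 / ε) (by positivity)
  have h2 := isProbabilityMeasure_laplace (b := 4 / ε) (by positivity)
  have hm := measurable_run ε δ k G s hS
  rw [Measure.map_apply (measurable_run ε δ k G s) hS, noiseLaw, Measure.prod_apply hm]
  refine lintegral_congr fun x => ?_
  rw [Measure.prod_apply (measurable_prodMk_left hm)]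
  refine lintegral_congr fun y => ?_
  rw [Measure.prod_apply (measurable_prodMk_left (measurable_prodMk_left hm))]
  rfl

theorem condProb_le_one (ε δ : ℝ) (k : ℕ) (G : SimpleGraph V) (s : Split V)
    (S : Set (View V δ)) (t w : ℝ) (P : Fin (projDim V δ) → s.Y → ℝ) :
    condProb ε δ k G s S t w P ≤ 1 := prob_le_one

theorem exp_three_eighths_le : Real.exp (3 / 8) ≤ 3 / 2 := by
  have h := Real.exp_one_lt_d9
  have h1 : Real.exp (3 / 8) ^ 8 = Real.exp 1 ^ 3 := by
    rw [← Real.exp_nat_mul, ← Real.exp_nat_mul]; norm_num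
  refine (pow_le_pow_iff_left₀ (Real.exp_nonneg _) (by norm_num) (n := 8) (by norm_num)).1 ?_
  rw [h1]
  calc Real.exp 1 ^ 3 ≤ 2.7182818286 ^ 3 := pow_le_pow_left₀ (Real.exp_nonneg _) h.le 3
    _ ≤ _ := by norm_num

theorem gaussianMatrix_affine_le {a b : Type*} [Fintype a] [Fintype b] {A A' : a → b → ℝ}
    {τ ε c : ℝ} (hε : 0 < ε) (hc : 0 < c) (hcε : ε ≤ 2 * c ^ 2) (hτ : 0 ≤ τ)
    (hA : ∑ i, ∑ j, (A i j - A' i j) ^ 2 ≤ (τ * (ε / c)) ^ 2) {T : Set (a → b → ℝ)}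
    (hT : MeasurableSet T) :
    gaussianMatrix a b 1 {N | (fun i j => A i j + τ * N i j) ∈ T} ≤ ENNReal.ofReal (Real.exp ε) *
      gaussianMatrix a b 1 {N | (fun i j => A' i j + τ * N i j) ∈ T} +
        ENNReal.ofReal (Real.exp (-c ^ 2 / 2 + ε / 2)) := by
  rcases hτ.eq_or_lt with h0 | h0
  -- Zero noise is possible when w = 0; the sensitivity bound then forces the two means to agree.
  · rw [← h0, zero_mul, zero_pow two_ne_zero] at hA
    have hAA' : A = A' := by
      ext i j
      have h1 := le_antisymm hA (Finset.sum_nonneg fun i _ =>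
        Finset.sum_nonneg fun j _ => sq_nonneg _)
      have h2 := (Finset.sum_eq_zero_iff_of_nonneg fun i _ =>
        Finset.sum_nonneg fun j _ => sq_nonneg (A i j - A' i j)).1 h1 i (Finset.mem_univ i)
      have h3 := (Finset.sum_eq_zero_iff_of_nonneg fun j _ => sq_nonneg (A i j - A' i j)).1 h2 j
        (Finset.mem_univ j)
      exact sub_eq_zero.1 (pow_eq_zero_iff two_ne_zero |>.1 h3)
    rw [hAA']
    refine le_add_right (le_mul_of_one_le_left zero_le ?_)
    rw [ENNReal.one_le_ofReal, Real.one_le_exp_iff]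
    exact hε.le
  · have hm : Measurable fun (N : a → b → ℝ) i j => A i j + τ * N i j := by fun_prop
    have h1 := gaussianMatrix_le_shift (fun i j => (A' i j - A i j) / τ) hε hc hcε (by
      have h2 : ∑ i, ∑ j, ((A' i j - A i j) / τ) ^ 2 =
          (∑ i, ∑ j, (A' i j - A i j) ^ 2) / τ ^ 2 := by
        simp only [div_pow, ← Finset.sum_div]
      rw [h2, div_le_iff₀ (by positivity), ← mul_pow, mul_comm (ε / c)]
      simpa only [sub_sq_comm] using hA) (hm hT)
    refine h1.trans (le_of_eq ?_)
    congr 3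
    ext N
    simp only [Set.mem_preimage, Set.mem_ofPred_eq, Pi.add_apply]
    have h2 : (fun i j => A i j + τ * (N i j + (A' i j - A i j) / τ)) =
        fun i j => A' i j + τ * N i j := by
      ext i j
      field_simp
      ring
    rw [h2]

theorem condProb_of_lt {ε δ : ℝ} {k : ℕ} {G : SimpleGraph V} {s : Split V} {S : Set (View V δ)}
    {t w : ℝ} {P : Fin (projDim V δ) → s.Y → ℝ}
    (ht : 10 * (8 / ε * Real.log (4 / δ)) < t) :
    condProb ε δ k G s S t w P = gaussianMatrix (Fin (projDim V δ)) s.Z₂ 1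
      {N | (fun i z => (Matrix.of P * projected k G s) i z +
        3 * k * (w / t) / ε * √(2 * Real.log (5 / δ)) * N i z) ∈
        {F | (⟨s, t, w, Sum.inr F⟩ : View V δ) ∈ S}} := by
  simp only [condProb, result, if_neg (not_le.2 ht)]
  rfl

/-- The Gaussian mechanism with privacy parameter 3ε/4, leaving ε/4 for the Laplace values. -/
theorem condProb_le_of_good {ε δ : ℝ} (hε : 0 < ε) (hε1 : ε < 1) (hδ : 0 < δ) (hδ1 : δ < 1)
    (k : ℕ) (G G' : SimpleGraph V) (s : Split V) {S : Set (View V δ)}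
    (hS : MeasurableSet S) {t w : ℝ} {P : Fin (projDim V δ) → s.Y → ℝ} (hw : 0 ≤ w)
    (ht : 10 * (8 / ε * Real.log (4 / δ)) < t → ∑ i, ∑ z,
      (Matrix.of P * (projected k G s - projected k G' s)) i z ^ 2 ≤ (9 / 4 * k * (w / t)) ^ 2) :
    condProb ε δ k G s S t w P ≤ ENNReal.ofReal (Real.exp (3 * ε / 4)) *
      condProb ε δ k G' s S t w P + ENNReal.ofReal (3 / 10 * δ) := by
  -- Below the threshold both graphs return ⊥, and no sensitivity bound is needed.
  by_cases hthr : t ≤ 10 * (8 / ε * Real.log (4 / δ))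
  · have h1 : condProb ε δ k G s S t w P = condProb ε δ k G' s S t w P := by
      simp only [condProb, result, if_pos hthr]
    rw [h1]
    refine le_add_right (le_mul_of_one_le_left zero_le ?_)
    rw [ENNReal.one_le_ofReal, Real.one_le_exp_iff]
    positivity
  have hthr' := not_le.1 hthr
  have hb := ht hthr'
  have hlog : 0 < Real.log (4 / δ) := Real.log_pos (by rw [lt_div_iff₀ hδ]; linarith)
  have hlog5 : 1 ≤ Real.log (5 / δ) := by
    rw [Real.le_log_iff_exp_le (by positivity)]
    have := Real.exp_one_lt_d9
    rw [le_div_iff₀ hδ]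
    nlinarith
  have ht0 : 0 < t := lt_trans (by positivity) hthr'
  rw [condProb_of_lt hthr', condProb_of_lt hthr']
  generalize hc : √(2 * Real.log (5 / δ)) = c
  have hc2 : c ^ 2 = 2 * Real.log (5 / δ) := by rw [← hc]; exact Real.sq_sqrt (by linarith)
  have hc0 : 0 < c := by rw [← hc]; exact Real.sqrt_pos.2 (by linarith)
  -- Here exp(-c²/2) = δ/5, and the remaining factor is at most exp(3/8) ≤ 3/2.
  have hgauss : Real.exp (-c ^ 2 / 2 + 3 * ε / 4 / 2) ≤ 3 / 10 * δ := by
    have e1 : -c ^ 2 / 2 = -Real.log (5 / δ) := by rw [hc2]; ring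
    rw [Real.exp_add, e1, Real.exp_neg, Real.exp_log (by positivity), inv_div]
    have e2 : Real.exp (3 * ε / 4 / 2) ≤ 3 / 2 :=
      (Real.exp_le_exp.2 (by linarith)).trans exp_three_eighths_le
    nlinarith
  have hTm : MeasurableSet {F : Fin (projDim V δ) → s.Z₂ → ℝ |
      (⟨s, t, w, Sum.inr F⟩ : View V δ) ∈ S} :=
    (measurable_mk s).comp (measurable_const.prodMk (measurable_const.prodMk measurable_inr)) hS
  refine (gaussianMatrix_affine_le (ε := 3 * ε / 4) (c := c) (by positivity) hc0
    (by rw [hc2]; linarith) (by positivity) ?_ hTm).trans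
    (add_le_add le_rfl (ENNReal.ofReal_le_ofReal hgauss))
  refine le_trans (le_of_eq ?_) (hb.trans (le_of_eq ?_))
  · simp only [Matrix.mul_sub, Matrix.sub_apply]
  · congr 1
    field_simp
    ring

end FixedSplit

/-! ### Integrating over the noise for a fixed partition. -/

section FixedSplit

variable {V : Type*} [Fintype V] [DecidableEq V]

theorem lintegral_laplace_laplace_le_shift {α : Type*} [MeasurableSpace α] (μ : Measure α)
    [SFinite μ] {b b' : ℝ} (hb : 0 < b) (hb' : 0 < b') (g g' h h' : ℝ)
    {Φ : ℝ × ℝ × α → ENNReal} (hΦ : Measurable Φ) :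
    ∫⁻ x, ∫⁻ y, ∫⁻ P, Φ (g + x, h + y, P) ∂μ ∂laplace b' ∂laplace b ≤
      ENNReal.ofReal (Real.exp (|g - g'| / b + |h - h'| / b')) *
        ∫⁻ x, ∫⁻ y, ∫⁻ P, Φ (g' + x, h' + y, P) ∂μ ∂laplace b' ∂laplace b := by
  have := isProbabilityMeasure_laplace hb'
  have h1 : Measurable fun p : ℝ × ℝ => ∫⁻ P, Φ (p.1, p.2, P) ∂μ :=
    Measurable.lintegral_prod_right' (f := fun q : (ℝ × ℝ) × α => Φ (q.1.1, q.1.2, q.2))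
      (by fun_prop)
  have h2 : ∀ h, Measurable fun t => ∫⁻ y, ∫⁻ P, Φ (t, h + y, P) ∂μ ∂laplace b' := fun h =>
    Measurable.lintegral_prod_right' (f := fun q : ℝ × ℝ => ∫⁻ P, Φ (q.1, h + q.2, P) ∂μ)
      (h1.comp (measurable_fst.prodMk (measurable_snd.const_add h)))
  have h3 : ∀ x, ∫⁻ y, ∫⁻ P, Φ (g + x, h + y, P) ∂μ ∂laplace b' ≤
      ENNReal.ofReal (Real.exp (|h - h'| / b')) *
        ∫⁻ y, ∫⁻ P, Φ (g + x, h' + y, P) ∂μ ∂laplace b' := fun x =>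
    lintegral_laplace_le_shift hb' h h' (ψ := fun w => ∫⁻ P, Φ (g + x, w, P) ∂μ)
      (h1.comp (measurable_const.prodMk measurable_id))
  refine (lintegral_mono h3).trans ?_
  have h4 : Measurable fun x => ∫⁻ y, ∫⁻ P, Φ (g + x, h' + y, P) ∂μ ∂laplace b' :=
    (h2 h').comp (measurable_const_add g)
  rw [lintegral_const_mul _ h4, add_comm, Real.exp_add,
    ENNReal.ofReal_mul (Real.exp_nonneg _), mul_assoc]
  gcongr
  exact lintegral_laplace_le_shift hb g g' (h2 h')

/-- On the bad sets the trivial bound 1 is used, and a union bound adds their measures; `J` is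
replaced by a measurable hull of the same measure. -/
theorem lintegral_le_of_good {α : Type*} [MeasurableSpace α] (μ : Measure α)
    [IsProbabilityMeasure μ] (ν ν' : Measure ℝ) [IsProbabilityMeasure ν] [IsProbabilityMeasure ν']
    {Φ Ψ : ℝ → ℝ → α → ENNReal} (hΦ : ∀ x y P, Φ x y P ≤ 1)
    (hΨ : Measurable fun p : ℝ × ℝ × α => Ψ p.1 p.2.1 p.2.2) {C D : ENNReal}
    {A B : Set ℝ} {J : Set α} (hA : MeasurableSet A) (hB : MeasurableSet B)
    (hgood : ∀ x ∉ A, ∀ y ∉ B, ∀ P ∉ J, Φ x y P ≤ C * Ψ x y P + D) :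
    ∫⁻ x, ∫⁻ y, ∫⁻ P, Φ x y P ∂μ ∂ν' ∂ν ≤
      C * (∫⁻ x, ∫⁻ y, ∫⁻ P, Ψ x y P ∂μ ∂ν' ∂ν) + (D + ν A + ν' B + μ J) := by
  have hJ := measurableSet_toMeasurable μ J
  set J' := toMeasurable μ J with hJ'
  have hΨ1 : ∀ x y, Measurable fun P => Ψ x y P := fun x y =>
    hΨ.comp (measurable_const.prodMk (measurable_const.prodMk measurable_id))
  have hΨ2 : Measurable fun p : ℝ × ℝ => ∫⁻ P, Ψ p.1 p.2 P ∂μ :=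
    Measurable.lintegral_prod_right' (f := fun q : (ℝ × ℝ) × α => Ψ q.1.1 q.1.2 q.2)
      (hΨ.comp ((measurable_fst.comp measurable_fst).prodMk
        ((measurable_snd.comp measurable_fst).prodMk measurable_snd)))
  have hΨ3 : ∀ x, Measurable fun y => ∫⁻ P, Ψ x y P ∂μ := fun x =>
    hΨ2.comp (measurable_const.prodMk measurable_id)
  have hΨ4 : Measurable fun x => ∫⁻ y, ∫⁻ P, Ψ x y P ∂μ ∂ν' := hΨ2.lintegral_prod_right'
  have hpt : ∀ x y P, Φ x y P ≤ C * Ψ x y P + (D + A.indicator 1 x + B.indicator 1 y +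
      J'.indicator 1 P) := by
    intro x y P
    by_cases hx : x ∈ A
    · refine (hΦ x y P).trans (le_add_left (le_add_right (le_add_right (le_add_left ?_))))
      simp [hx]
    by_cases hy : y ∈ B
    · refine (hΦ x y P).trans (le_add_left (le_add_right (le_add_left ?_)))
      simp [hy]
    by_cases hP : P ∈ J'
    · refine (hΦ x y P).trans (le_add_left (le_add_left ?_))
      simp [hP]
    refine (hgood x hx y hy P fun h => hP (subset_toMeasurable μ J h)).trans ?_
    simp only [Set.indicator_of_notMem hx, Set.indicator_of_notMem hy, Set.indicator_of_notMem hP,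
      add_zero, le_refl]
  have e1 : ∀ x y, ∫⁻ P, C * Ψ x y P + (D + A.indicator 1 x + B.indicator 1 y +
      J'.indicator 1 P) ∂μ = C * (∫⁻ P, Ψ x y P ∂μ) +
        (D + A.indicator 1 x + B.indicator 1 y + μ J) := by
    intro x y
    rw [lintegral_add_left ((hΨ1 x y).const_mul C), lintegral_const_mul _ (hΨ1 x y),
      lintegral_add_left measurable_const, lintegral_const, measure_univ, mul_one,
      lintegral_indicator_one hJ, hJ', measure_toMeasurable]
  have e2 : ∀ x, ∫⁻ y, (C * (∫⁻ P, Ψ x y P ∂μ) +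
        (D + A.indicator 1 x + B.indicator 1 y + μ J)) ∂ν' =
      C * (∫⁻ y, ∫⁻ P, Ψ x y P ∂μ ∂ν') + (D + A.indicator 1 x + ν' B + μ J) := by
    intro x
    have hBm : Measurable (B.indicator (1 : ℝ → ENNReal)) := measurable_one.indicator hB
    rw [lintegral_add_left ((hΨ3 x).const_mul C), lintegral_const_mul _ (hΨ3 x),
      lintegral_add_right _ measurable_const, lintegral_const, measure_univ, mul_one,
      lintegral_add_left measurable_const, lintegral_const, measure_univ, mul_one,
      lintegral_indicator_one hB]
  calc _ ≤ ∫⁻ x, ∫⁻ y, ∫⁻ P, C * Ψ x y P + (D + A.indicator 1 x + B.indicator 1 y +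
      J'.indicator 1 P) ∂μ ∂ν' ∂ν :=
        lintegral_mono fun x => lintegral_mono fun y => lintegral_mono fun P => hpt x y P
    _ = _ := by
        simp only [e1, e2]
        have hAm : Measurable (A.indicator (1 : ℝ → ENNReal)) := measurable_one.indicator hA
        rw [lintegral_add_left (hΨ4.const_mul C), lintegral_const_mul _ hΨ4,
          lintegral_add_right _ measurable_const, lintegral_const, measure_univ, mul_one,
          lintegral_add_right _ measurable_const, lintegral_const, measure_univ, mul_one,
          lintegral_add_left measurable_const, lintegral_const, measure_univ, mul_one,
          lintegral_indicator_one hA]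

/-- Conditional privacy is applied with the Laplace values centred as for G; only then are the
centres moved to those of G'. The parameter c is the lower bound demanded of σ̃₁: a larger c eases
the sensitivity condition but costs the tail term exp(ε(c - σ₁)/4). -/
theorem map_run_le {ε δ : ℝ} (hε : 0 < ε) (hε1 : ε < 1) (hδ : 0 < δ) (hδ1 : δ < 1)
    (hV : 4 ≤ Fintype.card V) (k : ℕ) (G G' : SimpleGraph V) (s : Split V) {c : ℝ} (hc : 0 ≤ c)
    (hshift : |gap k G s - gap k G' s| + 2 * |sigma (subAdj G s.Y s.Z₂) 1 -
      sigma (subAdj G' s.Y s.Z₂) 1| ≤ 2)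
    (hgood : ∀ t w, 10 * (8 / ε * Real.log (4 / δ)) < t → t ≤ gap k G s → c ≤ w →
      2 * ∑ y, ∑ z, (projected k G s - projected k G' s) y z ^ 2 ≤ (9 / 4 * k * (w / t)) ^ 2)
    {S : Set (View V δ)} (hS : MeasurableSet S) :
    (noiseLaw ε δ s).map (run ε δ k G s) S ≤
      ENNReal.ofReal (Real.exp ε) * (noiseLaw ε δ s).map (run ε δ k G' s) S +
        ENNReal.ofReal (11 / 20 * δ +
          δ / 8 * Real.exp (ε / 4 * (c - sigma (subAdj G s.Y s.Z₂) 1))) := by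
  have hb1 : 0 < 8 / ε := by positivity
  have hb2 : 0 < 4 / ε := by positivity
  have hp1 := isProbabilityMeasure_laplace hb1
  have hp2 := isProbabilityMeasure_laplace hb2
  have hm : Nonempty (Fin (projDim V δ)) := by
    refine ⟨⟨0, Nat.ceil_pos.2 (mul_pos (by norm_num) (Real.log_pos ?_))⟩⟩
    have hn : (4 : ℝ) ≤ Fintype.card V := by exact_mod_cast hV
    rw [lt_div_iff₀ hδ]
    linarith
  rw [map_run_apply hε δ k G s hS, map_run_apply hε δ k G' s hS]
  set L := Real.log (4 / δ) with hL
  set h := sigma (subAdj G s.Y s.Z₂) 1 with hh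
  set h' := sigma (subAdj G' s.Y s.Z₂) 1 with hh'
  set μ := gaussianMatrix (Fin (projDim V δ)) s.Y (1 / √(projDim V δ : ℝ)) with hμ
  set X := projected k G s - projected k G' s with hX
  have hexpL : Real.exp (-L) = δ / 4 := by
    rw [Real.exp_neg, hL, Real.exp_log (by positivity), inv_div]
  -- Outside this event d̃_k does not exceed the true gap, which is the purpose of the downward
  -- bias.
  have hA : laplace (8 / ε) (Set.Ioi (8 / ε * L)) ≤ ENNReal.ofReal (δ / 8) := by
    refine (laplace_Ioi_le hb1 _).trans (le_of_eq ?_)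
    rw [← mul_neg, mul_div_cancel_left₀ _ hb1.ne', hexpL]
    congr 1; ring
  have hB : laplace (4 / ε) (Set.Iio (c - h - 4 / ε * L)) ≤
      ENNReal.ofReal (δ / 8 * Real.exp (ε / 4 * (c - h))) := by
    refine (laplace_Iio_le hb2 _).trans (le_of_eq ?_)
    have : (c - h - 4 / ε * L) / (4 / ε) = ε / 4 * (c - h) + -L := by field_simp; ring
    rw [this, Real.exp_add, hexpL]
    congr 1; ring
  have hJ : μ {P | 2 * ∑ y, ∑ z, X y z ^ 2 < ∑ i, ∑ z, (Matrix.of P * X) i z ^ 2} ≤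
      ENNReal.ofReal (δ / 8) := by
    have h1 := gaussianMatrix_norm_mul_tail (a := Fin (projDim V δ)) X
    rw [Fintype.card_fin] at h1
    exact h1.trans (ENNReal.ofReal_le_ofReal (exp_neg_mul_sqrt_two_pow_le hV hδ hδ1))
  have hΨ : Measurable fun p : ℝ × ℝ × (Fin (projDim V δ) → s.Y → ℝ) =>
      condProb ε δ k G' s S (gap k G s - 8 / ε * L + p.1) (h + 4 / ε * L + p.2.1) p.2.2 := by
    have h1 : Measurable fun p : ℝ × ℝ × (Fin (projDim V δ) → s.Y → ℝ) =>
      (gap k G s - 8 / ε * L + p.1, h + 4 / ε * L + p.2.1, p.2.2) := by fun_prop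
    exact (measurable_condProb ε δ k G' s hS).comp h1
  have step1 := lintegral_le_of_good μ (laplace (8 / ε)) (laplace (4 / ε))
    (Φ := fun x y P => condProb ε δ k G s S (gap k G s - 8 / ε * L + x) (h + 4 / ε * L + y) P)
    (Ψ := fun x y P => condProb ε δ k G' s S (gap k G s - 8 / ε * L + x) (h + 4 / ε * L + y) P)
    (fun x y P => condProb_le_one _ _ _ _ _ _ _ _ _) hΨ
    (C := ENNReal.ofReal (Real.exp (3 * ε / 4))) (D := ENNReal.ofReal (3 / 10 * δ))
    (A := Set.Ioi (8 / ε * L)) (B := Set.Iio (c - h - 4 / ε * L))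
    (J := {P | 2 * ∑ y, ∑ z, X y z ^ 2 < ∑ i, ∑ z, (Matrix.of P * X) i z ^ 2})
    measurableSet_Ioi measurableSet_Iio fun x hx y hy P hP => by
      simp only [Set.mem_Ioi, Set.mem_Iio, Set.mem_ofPred_eq, not_lt] at hx hy hP
      have hw : c ≤ h + 4 / ε * L + y := by linarith
      exact condProb_le_of_good hε hε1 hδ hδ1 k G G' s hS (hc.trans hw) fun ht =>
        hP.trans (hgood _ _ ht (by linarith) hw)
  have step2 := lintegral_laplace_laplace_le_shift μ hb1 hb2 (gap k G s - 8 / ε * L)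
    (gap k G' s - 8 / ε * L) (h + 4 / ε * L) (h' + 4 / ε * L)
    (measurable_condProb ε δ k G' s hS)
  refine step1.trans (add_le_add ?_ ?_)
  · refine (mul_le_mul_right step2 _).trans ?_
    rw [← mul_assoc, ← ENNReal.ofReal_mul (Real.exp_nonneg _), ← Real.exp_add]
    -- The weighted shift hypothesis makes the two Laplace costs at most ε/4 in total.
    refine mul_le_mul_left (ENNReal.ofReal_le_ofReal (Real.exp_le_exp.2 ?_)) _
    rw [sub_sub_sub_cancel_right, add_sub_add_right_eq_sub, div_div_eq_mul_div, div_div_eq_mul_div]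
    nlinarith
  · refine (add_le_add (add_le_add (add_le_add le_rfl hA) hB) hJ).trans (le_of_eq ?_)
    have := Real.exp_nonneg (ε / 4 * (c - h))
    rw [← ENNReal.ofReal_add (by positivity) (by positivity),
      ← ENNReal.ofReal_add (by positivity) (by positivity),
      ← ENNReal.ofReal_add (by positivity) (by positivity)]
    congr 1
    ring

end FixedSplit

/-! ### The effect of one edge on the two blocks. -/

section EdgeChange

variable {V : Type*} [Fintype V] [DecidableEq V]

theorem subAdj_apply (G : SimpleGraph V) (R C : Finset V) [DecidableRel G.Adj] (y : R) (z : C) :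
    subAdj G R C y z = if G.Adj y z then 1 else 0 := by
  simp only [subAdj, Matrix.submatrix_apply, SimpleGraph.adjMatrix_apply]
  congr

theorem sum_sq_subAdj_row (G : SimpleGraph V) (R C : Finset V) (y : R) :
    ∑ z, subAdj G R C y z ^ 2 = nbrCount G y C := by
  classical
  simp only [subAdj_apply, ite_pow, one_pow, zero_pow two_ne_zero]
  rw [nbrCount, Finset.sum_coe_sort C fun z => if G.Adj y z then (1 : ℝ) else 0, Finset.sum_boole]

/-- Disjointness of rows and columns allows the edge to occur in only one orientation, hence in one
entry. -/
theorem subAdj_eq_or_exists_single {G G' : SimpleGraph V} {e : Sym2 V}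
    (h : ∀ a b, s(a, b) ≠ e → (G.Adj a b ↔ G'.Adj a b)) {R C : Finset V} (hRC : Disjoint R C) :
    subAdj G R C = subAdj G' R C ∨ ∃ (y₀ : R) (z₀ : C) (c : ℝ), |c| ≤ 1 ∧ s(y₀.1, z₀.1) = e ∧
      ∀ y z, subAdj G' R C y z = subAdj G R C y z + if y = y₀ ∧ z = z₀ then c else 0 := by
  classical
  by_cases he : ∃ (y₀ : R) (z₀ : C), s(y₀.1, z₀.1) = e
  · obtain ⟨y₀, z₀, he⟩ := he
    refine Or.inr ⟨y₀, z₀, subAdj G' R C y₀ z₀ - subAdj G R C y₀ z₀, ?_, he, fun y z => ?_⟩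
    · rw [subAdj_apply, subAdj_apply]
      split_ifs <;> norm_num
    · by_cases hyz : y = y₀ ∧ z = z₀
      · rw [if_pos hyz, hyz.1, hyz.2]; ring
      · rw [if_neg hyz, add_zero, subAdj_apply, subAdj_apply]
        have hne : s(y.1, z.1) ≠ e := by
          rw [← he, ne_eq, Sym2.eq_iff]
          rintro (⟨h1, h2⟩ | ⟨h1, h2⟩)
          · exact hyz ⟨Subtype.ext h1, Subtype.ext h2⟩
          · exact Finset.disjoint_left.1 hRC y.2 (h1 ▸ z₀.2)
        simp only [h _ _ hne]
  · left
    ext y z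
    have hne : s(y.1, z.1) ≠ e := fun h => he ⟨y, z, h⟩
    rw [subAdj_apply, subAdj_apply]
    simp only [h _ _ hne]

/-- If both blocks contained the edge, its endpoints would force two of `Y`, `Z₁`, `Z₂` to
intersect. -/
theorem split_subAdj_cases {G G' : SimpleGraph V} {e : Sym2 V}
    (h : ∀ a b, s(a, b) ≠ e → (G.Adj a b ↔ G'.Adj a b)) (s : Split V) :
    (subAdj G s.Y s.Z₂ = subAdj G' s.Y s.Z₂ ∧
      (subAdj G s.Y s.Z₁ = subAdj G' s.Y s.Z₁ ∨ ∃ y₀ z₀ c, |c| ≤ 1 ∧ ∀ y z,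
        subAdj G' s.Y s.Z₁ y z = subAdj G s.Y s.Z₁ y z + if y = y₀ ∧ z = z₀ then c else 0)) ∨
    (subAdj G s.Y s.Z₁ = subAdj G' s.Y s.Z₁ ∧
      ∃ (y₀ : s.Y) (z₀ : s.Z₂) (c : ℝ), |c| ≤ 1 ∧ y₀.1 ∈ e ∧ ∀ y z,
        subAdj G' s.Y s.Z₂ y z = subAdj G s.Y s.Z₂ y z + if y = y₀ ∧ z = z₀ then c else 0) := by
  have hd1 : Disjoint s.Y s.Z₁ := s.2.1
  have hd2 : Disjoint s.Y s.Z₂ := s.2.2.1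
  have hd3 : Disjoint s.Z₁ s.Z₂ := s.2.2.2.1
  rcases subAdj_eq_or_exists_single h hd2 with h2 | ⟨y₂, z₂, c₂, hc₂, he₂, h2⟩
  · refine Or.inl ⟨h2, ?_⟩
    rcases subAdj_eq_or_exists_single h hd1 with h1 | ⟨y₁, z₁, c₁, hc₁, -, h1⟩
    · exact Or.inl h1
    · exact Or.inr ⟨y₁, z₁, c₁, hc₁, h1⟩
  · refine Or.inr ⟨?_, y₂, z₂, c₂, hc₂, he₂ ▸ Sym2.mem_mk_left _ _, h2⟩
    rcases subAdj_eq_or_exists_single h hd1 with h1 | ⟨y₁, z₁, c₁, -, he₁, -⟩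
    · exact h1
    · exfalso
      rw [← he₂, Sym2.eq_iff] at he₁
      rcases he₁ with ⟨-, h4⟩ | ⟨h4, -⟩
      · exact Finset.disjoint_left.1 hd3 z₁.2 (h4 ▸ z₂.2)
      · exact Finset.disjoint_left.1 hd2 y₁.2 (h4 ▸ z₂.2)

theorem abs_sigma_sub_le {m n : Type*} [Fintype m] [DecidableEq m] [Fintype n] [DecidableEq n]
    {M M' : Matrix m n ℝ} {y₀ : m} {z₀ : n} {c : ℝ} (hc : |c| ≤ 1)
    (h : ∀ y z, M' y z = M y z + if y = y₀ ∧ z = z₀ then c else 0) (i : ℕ) :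
    |sigma M i - sigma M' i| ≤ 1 := by
  have h1 := sigma_le_sigma_add hc h i
  have h2 := sigma_le_sigma_add (M := M') (M' := M) (y₀ := y₀) (z₀ := z₀) (c := -c) (by rwa [abs_neg])
    (fun y z => by rw [h y z]; split_ifs <;> ring) i
  rw [abs_le]
  constructor <;> linarith

theorem eighty_lt_of_threshold_lt {ε δ t : ℝ} (hε : 0 < ε) (hε1 : ε < 1) (hδ : 0 < δ)
    (hδ1 : δ < 1) (ht : 10 * (8 / ε * Real.log (4 / δ)) < t) : 80 < t := by
  have h1 : 1 ≤ Real.log (4 / δ) := by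
    rw [Real.le_log_iff_exp_le (by positivity), le_div_iff₀ hδ]
    have := Real.exp_one_lt_d9
    nlinarith
  have h2 : 8 ≤ 8 / ε := by rw [le_div_iff₀ hε]; linarith
  nlinarith

theorem map_run_le_of_gap_change {ε δ : ℝ} (hε : 0 < ε) (hε1 : ε < 1) (hδ : 0 < δ) (hδ1 : δ < 1)
    (hV : 4 ≤ Fintype.card V) {k : ℕ} (hk : 1 ≤ k) {G G' : SimpleGraph V} {s : Split V}
    (h2 : subAdj G s.Y s.Z₂ = subAdj G' s.Y s.Z₂)
    (h1 : subAdj G s.Y s.Z₁ = subAdj G' s.Y s.Z₁ ∨ ∃ y₀ z₀ c, |c| ≤ 1 ∧ ∀ y z,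
        subAdj G' s.Y s.Z₁ y z = subAdj G s.Y s.Z₁ y z + if y = y₀ ∧ z = z₀ then c else 0)
    {S : Set (View V δ)} (hS : MeasurableSet S) :
    (noiseLaw ε δ s).map (run ε δ k G s) S ≤
      ENNReal.ofReal (Real.exp ε) * (noiseLaw ε δ s).map (run ε δ k G' s) S +
        ENNReal.ofReal (27 / 40 * δ) := by
  have hk1 : (1 : ℝ) ≤ k := by exact_mod_cast hk
  -- With c = σ₁(Â₂) the tail term is δ/8, and 11/20 + 1/8 = 27/40.
  have hmain := map_run_le hε hε1 hδ hδ1 hV k G G' s (c := sigma (subAdj G s.Y s.Z₂) 1)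
    (sigma_nonneg _ _) ?_ ?_ hS
  · rw [sub_self, mul_zero, Real.exp_zero] at hmain
    refine hmain.trans (le_of_eq ?_)
    congr 2
    ring
  · rw [← h2, sub_self, abs_zero, mul_zero, add_zero, gap, gap]
    rcases h1 with h1 | ⟨y₀, z₀, c, hc, h1⟩
    · rw [← h1, sub_self, abs_zero]; exact zero_le_two
    · have e1 := abs_le.1 (abs_sigma_sub_le hc h1 k)
      have e2 := abs_le.1 (abs_sigma_sub_le hc h1 (k + 1))
      rw [abs_le]
      constructor <;> linarith
  · intro t w ht htg hw
    have ht80 := eighty_lt_of_threshold_lt hε hε1 hδ hδ1 ht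
    have hh := sigma_nonneg (subAdj G s.Y s.Z₂) 1
    set h := sigma (subAdj G s.Y s.Z₂) 1 with hhdef
    rcases h1 with h1 | ⟨y₀, z₀, c, hc, h1⟩
    · have : projected k G s = projected k G' s := by rw [projected, projected, h1, h2]
      rw [this, sub_self]
      simp only [Matrix.zero_apply, zero_pow two_ne_zero, Finset.sum_const_zero, mul_zero]
      positivity
    · have hX : projected k G s - projected k G' s =
          (topProj k (subAdj G s.Y s.Z₁) - topProj k (subAdj G' s.Y s.Z₁)) *
            subAdj G s.Y s.Z₂ := by
        rw [projected, projected, ← h2, Matrix.sub_mul]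
      have e1 := sum_sq_mul_le (topProj k (subAdj G s.Y s.Z₁) - topProj k (subAdj G' s.Y s.Z₁))
        (subAdj G s.Y s.Z₂)
      simp only [Matrix.sub_apply] at e1
      rw [gap] at htg
      have e2 := sum_sq_topProj_sub_le hc h1 hk (by linarith)
      set d := sigma (subAdj G s.Y s.Z₁) k - sigma (subAdj G s.Y s.Z₁) (k + 1) with hd
      have e3 := mul_le_mul_of_nonneg_right e2 (sq_nonneg h)
      rw [hX]
      refine (mul_le_mul_of_nonneg_left (e1.trans e3) zero_le_two).trans ?_
      have e4 : 2 * (2 * (1 / (d - 1)) ^ 2 * h ^ 2) = (2 * h / (d - 1)) ^ 2 := by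
        rw [div_pow, div_pow]; ring
      rw [e4]
      refine pow_le_pow_left₀ (div_nonneg (by positivity) (by linarith)) ?_ 2
      calc 2 * h / (d - 1) ≤ 2 * w / (t - 1) := by
            apply div_le_div₀ <;> linarith
        -- This needs only t ≥ 9.
        _ ≤ 9 / 4 * 1 * (w / t) := by
            rw [mul_div_assoc', div_le_div_iff₀ (by linarith) (by linarith)]
            nlinarith
        _ ≤ _ := by
            have : 0 ≤ w / t := div_nonneg (hh.trans hw) (by linarith)
            gcongr

theorem two_fifths_le_log : 2 / 5 ≤ Real.log (3 / 2) := by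
  rw [Real.le_log_iff_exp_le (by norm_num)]
  have h := Real.exp_one_lt_d9
  have h1 : Real.exp (2 / 5) ^ 5 = Real.exp 1 ^ 2 := by
    rw [← Real.exp_nat_mul, ← Real.exp_nat_mul]; norm_num
  refine (pow_le_pow_iff_left₀ (Real.exp_nonneg _) (by norm_num) (n := 5) (by norm_num)).1 ?_
  rw [h1]
  calc Real.exp 1 ^ 2 ≤ 2.7182818286 ^ 2 := pow_le_pow_left₀ (Real.exp_nonneg _) h.le 2
    _ ≤ _ := by norm_num

/-- If h ≥ (2/3)√D₁ the left side is at most 1. Otherwise D₂ < (4/9) D₁, and with r = √D₁ the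
logarithm of the product term grows like (ln(3/2) - (4/9) ln 2) r², a positive multiple of r². The
factor 5/4 covers small r, where this quadratic alone would not dominate r/6. -/
theorem exp_sqrt_sub_le {ε h : ℝ} (hε : 0 < ε) (hε1 : ε < 1) (hh : 0 ≤ h) (D₁ D₂ : ℕ)
    (hD : (D₂ : ℝ) ≤ h ^ 2) :
    Real.exp (ε / 4 * (2 / 3 * √(D₁ : ℝ) - h)) ≤ 1 + 5 / 4 * ((3 / 2) ^ D₁ * (1 / 2) ^ D₂) := by
  have hF : (0 : ℝ) ≤ 5 / 4 * ((3 / 2) ^ D₁ * (1 / 2) ^ D₂) := by positivity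
  rcases le_or_gt (2 / 3 * √(D₁ : ℝ)) h with hle | hlt
  · have : Real.exp (ε / 4 * (2 / 3 * √(D₁ : ℝ) - h)) ≤ 1 := by
      rw [Real.exp_le_one_iff]
      exact mul_nonpos_of_nonneg_of_nonpos (by positivity) (by linarith)
    linarith
  · set r := √(D₁ : ℝ) with hr
    have hr0 : 0 ≤ r := Real.sqrt_nonneg _
    have hr2 : r ^ 2 = D₁ := Real.sq_sqrt (Nat.cast_nonneg _)
    have hD' : (D₂ : ℝ) ≤ 4 / 9 * r ^ 2 := by nlinarith
    have e1 : (5 / 4 : ℝ) = Real.exp (Real.log (5 / 4)) := (Real.exp_log (by norm_num)).symm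
    have e2 : (3 / 2 : ℝ) ^ D₁ = Real.exp (D₁ * Real.log (3 / 2)) := by
      rw [Real.exp_nat_mul, Real.exp_log (by norm_num)]
    have e3 : (1 / 2 : ℝ) ^ D₂ = Real.exp (-(D₂ * Real.log 2)) := by
      rw [← mul_neg, Real.exp_nat_mul, Real.exp_neg, Real.exp_log two_pos, one_div]
    have h1 : (1 / 5 : ℝ) ≤ Real.log (5 / 4) := by
      have := Real.one_sub_inv_le_log_of_pos (x := 5 / 4) (by norm_num)
      norm_num at this
      linarith
    have h2 := two_fifths_le_log
    have h3 := Real.log_two_lt_d9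
    have h4 : Real.exp (ε / 4 * (2 / 3 * r - h)) ≤ 5 / 4 * ((3 / 2) ^ D₁ * (1 / 2) ^ D₂) := by
      rw [e1, e2, e3, ← Real.exp_add, ← Real.exp_add, Real.exp_le_exp, ← hr2]
      have f1 : ε / 4 * (2 / 3 * r - h) ≤ r / 6 := by nlinarith
      have f2 : (D₂ : ℝ) * Real.log 2 ≤ 4 / 9 * r ^ 2 * 0.6931471808 :=
        mul_le_mul hD' h3.le (Real.log_nonneg one_le_two) (by positivity)
      have f3 : r ^ 2 * (2 / 5) ≤ r ^ 2 * Real.log (3 / 2) :=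
        mul_le_mul_of_nonneg_left h2 (sq_nonneg r)
      nlinarith [sq_nonneg (r - 1)]
    linarith

theorem map_run_le_of_top_change {ε δ : ℝ} (hε : 0 < ε) (hε1 : ε < 1) (hδ : 0 < δ) (hδ1 : δ < 1)
    (hV : 4 ≤ Fintype.card V) {k : ℕ} (hk : 1 ≤ k) {G G' : SimpleGraph V} {s : Split V}
    (h1 : subAdj G s.Y s.Z₁ = subAdj G' s.Y s.Z₁) {y₀ : s.Y} {z₀ : s.Z₂} {c : ℝ} (hc : |c| ≤ 1)
    (h2 : ∀ y z,
        subAdj G' s.Y s.Z₂ y z = subAdj G s.Y s.Z₂ y z + if y = y₀ ∧ z = z₀ then c else 0)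
    {S : Set (View V δ)} (hS : MeasurableSet S) :
    (noiseLaw ε δ s).map (run ε δ k G s) S ≤
      ENNReal.ofReal (Real.exp ε) * (noiseLaw ε δ s).map (run ε δ k G' s) S +
        ENNReal.ofReal (27 / 40 * δ + 5 / 32 * δ *
          ((3 / 2) ^ nbrCount G y₀ s.Z₁ * (1 / 2) ^ nbrCount G y₀ s.Z₂)) := by
  have hk1 : (1 : ℝ) ≤ k := by exact_mod_cast hk
  set D₁ := nbrCount G y₀ s.Z₁ with hD₁
  set D₂ := nbrCount G y₀ s.Z₂ with hD₂
  -- The constant 2/3 gives (9/4 · 2/3)² = 9/4 ≥ 2, which absorbs the factor 2 from the random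
  -- projection.
  have hmain := map_run_le hε hε1 hδ hδ1 hV k G G' s (c := 2 / 3 * √(D₁ : ℝ))
    (by positivity) ?_ ?_ hS
  · refine hmain.trans (add_le_add le_rfl (ENNReal.ofReal_le_ofReal ?_))
    have e1 := sum_sq_row_le (subAdj G s.Y s.Z₂) y₀
    rw [sum_sq_subAdj_row] at e1
    have e2 := exp_sqrt_sub_le hε hε1 (sigma_nonneg (subAdj G s.Y s.Z₂) 1) D₁ D₂ e1
    have e3 := mul_le_mul_of_nonneg_left e2 (show 0 ≤ δ / 8 by positivity)
    linarith
  · have e1 := abs_sigma_sub_le hc h2 1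
    rw [gap, gap, ← h1, sub_self, abs_zero]
    linarith
  · intro t w ht htg hw
    have ht0 : 0 < t := by linarith [eighty_lt_of_threshold_lt hε hε1 hδ hδ1 ht]
    -- The projection is common to both graphs, so the single changed entry picks out column y₀ of
    -- it.
    have hX : ∀ y z, (projected k G s - projected k G' s) y z =
        -(topProj k (subAdj G s.Y s.Z₁) y y₀ * if z = z₀ then c else 0) := by
      intro y z
      rw [projected, projected, ← h1, Matrix.sub_apply, Matrix.mul_apply, Matrix.mul_apply,
        ← Finset.sum_sub_distrib]
      rw [Finset.sum_eq_single y₀ (fun y' _ hy' => by simp [h2, hy']) (by simp), h2]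
      by_cases hz : z = z₀ <;> simp [hz]
      ring
    have hX2 : ∑ y, ∑ z, (projected k G s - projected k G' s) y z ^ 2 =
        (∑ y, topProj k (subAdj G s.Y s.Z₁) y y₀ ^ 2) * c ^ 2 := by
      simp only [hX, neg_sq, mul_pow, ite_pow, zero_pow two_ne_zero, ← Finset.mul_sum,
        Finset.sum_ite_eq', Finset.mem_univ, if_true, Finset.sum_mul]
    have e1 := sum_sq_topProj_col_mul_le hk (subAdj G s.Y s.Z₁) y₀
    rw [sum_sq_subAdj_row, ← hD₁] at e1
    have e2 : t ≤ sigma (subAdj G s.Y s.Z₁) k := by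
      have := sigma_nonneg (subAdj G s.Y s.Z₁) (k + 1)
      rw [gap] at htg
      linarith
    set F := ∑ y, topProj k (subAdj G s.Y s.Z₁) y y₀ ^ 2 with hF
    have hF0 : 0 ≤ F := Finset.sum_nonneg fun _ _ => sq_nonneg _
    have e3 : F * t ^ 2 ≤ D₁ :=
      (mul_le_mul_of_nonneg_left (pow_le_pow_left₀ ht0.le e2 2) hF0).trans e1
    have hc2 : c ^ 2 ≤ 1 := by rw [← sq_abs]; exact pow_le_one₀ (abs_nonneg _) hc
    have e4 : F * c ^ 2 ≤ D₁ / t ^ 2 := by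
      rw [le_div_iff₀ (by positivity)]
      nlinarith [mul_le_mul_of_nonneg_left hc2 hF0, sq_nonneg t]
    have hr2 : √(D₁ : ℝ) ^ 2 = D₁ := Real.sq_sqrt (Nat.cast_nonneg _)
    rw [hX2]
    calc 2 * (F * c ^ 2) ≤ 9 / 4 * (D₁ / t ^ 2) := by
          have : (0 : ℝ) ≤ D₁ / t ^ 2 := by positivity
          linarith
      _ = (9 / 4 * 1 * (2 / 3 * √(D₁ : ℝ) / t)) ^ 2 := by
          rw [mul_pow, div_pow, mul_pow (2 / 3), hr2]; ring
      _ ≤ _ := by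
          have : 0 ≤ w := le_trans (by positivity) hw
          gcongr

end EdgeChange

/-! ### Averaging over the partition, and post-processing. -/

section Privacy

variable {V : Type*} [Fintype V] [DecidableEq V]

/-- Which endpoint lies in `Y` depends on the partition, so the terms of both endpoints are kept and
the bound can be averaged over all partitions. -/
theorem map_run_le_of_edge {ε δ : ℝ} (hε : 0 < ε) (hε1 : ε < 1) (hδ : 0 < δ) (hδ1 : δ < 1)
    (hV : 4 ≤ Fintype.card V) {k : ℕ} (hk : 1 ≤ k) {G G' : SimpleGraph V} {u v : V}
    (h : ∀ a b, s(a, b) ≠ s(u, v) → (G.Adj a b ↔ G'.Adj a b)) (s : Split V)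
    {S : Set (View V δ)} (hS : MeasurableSet S) :
    (noiseLaw ε δ s).map (run ε δ k G s) S ≤
      ENNReal.ofReal (Real.exp ε) * (noiseLaw ε δ s).map (run ε δ k G' s) S +
        ENNReal.ofReal (27 / 40 * δ + 5 / 32 * δ *
          ((3 / 2) ^ nbrCount G u s.Z₁ * (1 / 2) ^ nbrCount G u s.Z₂ +
            (3 / 2) ^ nbrCount G v s.Z₁ * (1 / 2) ^ nbrCount G v s.Z₂)) := by
  have hu : (0 : ℝ) ≤ (3 / 2) ^ nbrCount G u s.Z₁ * (1 / 2) ^ nbrCount G u s.Z₂ := by positivity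
  have hv : (0 : ℝ) ≤ (3 / 2) ^ nbrCount G v s.Z₁ * (1 / 2) ^ nbrCount G v s.Z₂ := by positivity
  rcases split_subAdj_cases h s with ⟨h2, h1⟩ | ⟨h1, y₀, z₀, c, hc, hy₀, h2⟩
  · refine (map_run_le_of_gap_change hε hε1 hδ hδ1 hV hk h2 h1 hS).trans
      (add_le_add le_rfl (ENNReal.ofReal_le_ofReal ?_))
    have : 0 ≤ 5 / 32 * δ := by positivity
    nlinarith
  · refine (map_run_le_of_top_change hε hε1 hδ hδ1 hV hk h1 hc h2 hS).trans
      (add_le_add le_rfl (ENNReal.ofReal_le_ofReal ?_))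
    gcongr
    rcases Sym2.mem_iff.1 hy₀ with h | h
    · rw [h]; linarith
    · rw [h]; linarith

theorem isEdgeDP_releaseLaw (hV : 4 ∣ Fintype.card V) {k : ℕ} (hk : 1 ≤ k) {ε δ : ℝ} (hε : 0 < ε)
    (hε1 : ε < 1) (hδ : 0 < δ) (hδ1 : δ < 1) :
    IsEdgeDP ε δ fun G : SimpleGraph V => releaseLaw ε δ k G := by
  intro G G' hGG' S hS
  rcases Set.encard_le_one_iff_eq.1 hGG' with h0 | ⟨e, he⟩
  · have : G = G' := SimpleGraph.edgeSet_inj.1 (symmDiff_eq_bot.1 h0)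
    rw [this]
    refine le_add_right (le_mul_of_one_le_left zero_le ?_)
    rw [ENNReal.one_le_ofReal, Real.one_le_exp_iff]
    exact hε.le
  induction e with | h u v =>
  have hadj : ∀ a b, s(a, b) ≠ s(u, v) → (G.Adj a b ↔ G'.Adj a b) := fun a b hab => by
    have h1 : s(a, b) ∉ symmDiff G.edgeSet G'.edgeSet := by rw [he]; exact hab
    rw [Set.mem_symmDiff, SimpleGraph.mem_edgeSet, SimpleGraph.mem_edgeSet] at h1
    tauto
  have hV4 : 4 ≤ Fintype.card V := Nat.le_of_dvd (Fintype.card_pos_iff.2 ⟨u⟩) hV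
  have := nonempty_split hV
  set n := Fintype.card (Split V) with hn
  have hn0 : (n : ENNReal) ≠ 0 := by simp [hn]
  have hntop : (n : ENNReal) ≠ ⊤ := ENNReal.natCast_ne_top n
  set b : Split V → ℝ := fun s => 27 / 40 * δ + 5 / 32 * δ *
          ((3 / 2) ^ nbrCount G u s.Z₁ * (1 / 2) ^ nbrCount G u s.Z₂ +
            (3 / 2) ^ nbrCount G v s.Z₁ * (1 / 2) ^ nbrCount G v s.Z₂) with hb
  -- The mean is at most (27/40 + 2 · 5/32) δ = (79/80) δ.
  have hbsum : ∑ s, b s ≤ n * δ := by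
    have h1 := sum_split_nbrCount_le hV G u
    have h2 := sum_split_nbrCount_le hV G v
    simp only [hb, Finset.sum_add_distrib, ← Finset.mul_sum, Finset.sum_const, Finset.card_univ,
      nsmul_eq_mul, ← hn] at h1 h2 ⊢
    have h3 := mul_le_mul_of_nonneg_left (add_le_add h1 h2) (show 0 ≤ 5 / 32 * δ by positivity)
    have h4 : (0 : ℝ) ≤ n * δ := by positivity
    linarith
  have hbsum' : ∑ s, ENNReal.ofReal (b s) ≤ n * ENNReal.ofReal δ := by
    rw [← ENNReal.ofReal_sum_of_nonneg fun s _ => by positivity, ← ENNReal.ofReal_natCast,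
      ← ENNReal.ofReal_mul (Nat.cast_nonneg _)]
    exact ENNReal.ofReal_le_ofReal hbsum
  simp only [releaseLaw, Measure.smul_apply, Measure.finsetSum_apply, smul_eq_mul, ← hn]
  calc (n : ENNReal)⁻¹ * ∑ s, (noiseLaw ε δ s).map (run ε δ k G s) S
      ≤ (n : ENNReal)⁻¹ * ∑ s, (ENNReal.ofReal (Real.exp ε) *
          (noiseLaw ε δ s).map (run ε δ k G' s) S + ENNReal.ofReal (b s)) := by
        gcongr with s
        exact map_run_le_of_edge hε hε1 hδ hδ1 hV4 hk hadj s hS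
    _ ≤ (n : ENNReal)⁻¹ * (ENNReal.ofReal (Real.exp ε) *
          ∑ s, (noiseLaw ε δ s).map (run ε δ k G' s) S + n * ENNReal.ofReal δ) := by
        rw [Finset.sum_add_distrib, ← Finset.mul_sum]
        gcongr
    _ = _ := by
        rw [mul_add, ← mul_assoc (n : ENNReal)⁻¹ n, ENNReal.inv_mul_cancel hn0 hntop, one_mul,
          mul_left_comm]

theorem IsEdgeDP.map {α Out Out' : Type*} [MeasurableSpace Out] [MeasurableSpace Out'] {ε δ : ℝ}
    {M : SimpleGraph α → Measure Out} (hM : IsEdgeDP ε δ M) {f : Out → Out'} (hf : Measurable f) :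
    IsEdgeDP ε δ fun G => (M G).map f := by
  intro G G' h S hS
  simp only [Measure.map_apply hf hS]
  exact hM G G' h _ (hf hS)

end Privacy
end DPComm

theorem mainTheorem6 {V : Type*} [Fintype V] [DecidableEq V] (hV : 4 ∣ Fintype.card V)
    (k : ℕ) (hk : 1 ≤ k) (ε δ : ℝ) (hε : 0 < ε) (hε1 : ε < 1) (hδ : 0 < δ) (hδ1 : δ < 1) :
    DPComm.IsEdgeDP ε δ (fun G : SimpleGraph V => DPComm.dpCommunity ε δ k G) ∧
      DPComm.IsEdgeDP ε δ (fun G : SimpleGraph V => DPComm.releaseLaw ε δ k G) :=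
  have h := DPComm.isEdgeDP_releaseLaw hV hk hε hε1 hδ hδ1
  ⟨h.map (DPComm.measurable_toOutput δ), h⟩
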